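/- Consider open subsets $\Omega\subset\mathbb R^2$ with the Dirichlet Laplacian $\Delta_\Omega$ (weak formulation on $H^1_0(\Omega)$). Two such sets are isospectral if their Dirichlet Laplacians have discrete spectrum and the eigenvalues $\lambda_1\le\lambda_2\le\dots$ of $-\Delta$, repeated according to multiplicity, agree. The heat content is $Q_\Omega(t)=\int_\Omega u(x;t)\,dx$, where $u$ is the unique solution of $\partial u/\partial t=\Delta_\Omega u$ for $t>0$ with Dirichlet boundary conditions and $\lim_{t\downarrow0}u(\cdot;t)=1$ in $L^2(\Omega)$; two sets are isoheat if their heat contents agree for all $t>0$. Let $C\subset\mathbb R^2$ be a disjoint union of open squares $S_0,S_1,S_2,\dots$, where $S_j$ has area $2^{-j}$, together with an open right isosceles triangle of area $2$. Let $D\subset\mathbb R^2$ be a disjoint union of open rectangles $R_0,R_1,R_2,\dots$, where $R_j$ has area $2^{1-j}$ and diameter $2^{-j/2}\sqrt5$ (that is, edge lengths $2^{-j/2}$ and $2\cdot 2^{-j/2}$). Then the heat problems on $C$ and on $D$ have unique solutions, and $C$ and $D$ are isospectral but not isoheat. Moreover, for $t\to\infty$, $$Q_C(t)=\frac{1024}{9\pi^4}e^{-5\pi^2t/4}+O(e^{-2\pi^2t}),\qquad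 Q_D(t)=\frac{1152}{9\pi^4}e^{-5\pi^2t/4}+O(e^{-2\pi^2t}).$$ -/

import Mathlib

open MeasureTheory Filter Topology Asymptotics
open scoped ContDiff

/-- The Euclidean plane. -/
abbrev Plane : Type := EuclideanSpace ℝ (Fin 2)

/-- The real Hilbert space `L²(Ω)`. -/
abbrev L2Fun (Ω : Set Plane) : Type := Lp ℝ 2 ((volume : Measure Plane).restrict Ω)

/-- The real Hilbert space of square integrable vector fields on `Ω`. -/
abbrev L2Field (Ω : Set Plane) : Type := Lp Plane 2 ((volume : Measure Plane).restrict Ω)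

/-- Pairs `(φ, ∇φ)` in `L²(Ω) × L²(Ω; ℝ²)`, where `φ` is smooth with compact support in `Ω`. -/
def testPairs (Ω : Set Plane) : Set (L2Fun Ω × L2Field Ω) :=
  {p | ∃ φ : Plane → ℝ, ContDiff ℝ ∞ φ ∧ HasCompactSupport φ ∧ tsupport φ ⊆ Ω ∧
    (p.1 : Plane → ℝ) =ᵐ[volume.restrict Ω] φ ∧
    (p.2 : Plane → Plane) =ᵐ[volume.restrict Ω] gradient φ}

/-- The Sobolev space `H¹₀(Ω)`, the closure of the test functions in the norm of `H¹`; its elements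
are recorded as pairs `(f, ∇f)`. -/
def sobolevH10 (Ω : Set Plane) : Set (L2Fun Ω × L2Field Ω) := closure (testPairs Ω)

/-- `f` is in the domain of the Dirichlet Laplacian `Δ` of `Ω`, and `Δ f = h`: that is,
`f ∈ H¹₀(Ω)`, and `∫ ∇f · ∇v = - ∫ h v` for all `v ∈ H¹₀(Ω)`. -/
def HasDirichletLaplacian (Ω : Set Plane) (f h : L2Fun Ω) : Prop :=
  ∃ g : L2Field Ω, (f, g) ∈ sobolevH10 Ω ∧
    ∀ v ∈ sobolevH10 Ω, inner ℝ g v.2 = -inner ℝ h v.1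

/-- The Dirichlet Laplacian of `Ω` has discrete spectrum, and `ev 0 ≤ ev 1 ≤ ev 2 ≤ …` are the
eigenvalues of `-Δ`, each one repeated according to its multiplicity: `ev` tends to infinity, and
`L²(Ω)` has an orthonormal basis of eigenfunctions `b j` of `-Δ` with eigenvalues `ev j`. -/
def IsDirichletSpectrum (Ω : Set Plane) (ev : ℕ → ℝ) : Prop :=
  Monotone ev ∧ Tendsto ev atTop atTop ∧
    ∃ b : HilbertBasis ℕ ℝ (L2Fun Ω), ∀ j, HasDirichletLaplacian Ω (b j) (-(ev j • b j))

/-- `Ω₁` and `Ω₂` have discrete Dirichlet spectra, and these agree, with multiplicities. -/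
def Isospectral (Ω₁ Ω₂ : Set Plane) : Prop :=
  ∃ ev : ℕ → ℝ, IsDirichletSpectrum Ω₁ ev ∧ IsDirichletSpectrum Ω₂ ev

/-- `u` solves the heat equation `∂u/∂t = Δu` for `t > 0`, with Dirichlet boundary conditions and
with `u(·; t) → 1` in `L²(Ω)` as `t ↓ 0`. The values of `u` for `t ≤ 0` play no role. -/
def IsHeatSolution (Ω : Set Plane) (u : ℝ → L2Fun Ω) : Prop :=
  (∀ t : ℝ, 0 < t → ∃ h : L2Fun Ω, HasDirichletLaplacian Ω (u t) h ∧ HasDerivAt u h t) ∧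
    Tendsto (fun t : ℝ => eLpNorm (fun x => u t x - 1) 2 (volume.restrict Ω)) (𝓝[>] 0) (𝓝 0)

/-- The heat problem of `Ω` has a solution, and this is unique (for positive times). -/
def HasUniqueHeatSolution (Ω : Set Plane) : Prop :=
  ∃ u : ℝ → L2Fun Ω, IsHeatSolution Ω u ∧
    ∀ v : ℝ → L2Fun Ω, IsHeatSolution Ω v → ∀ t : ℝ, 0 < t → v t = u t

/-- The solution of the heat problem of `Ω`; meaningful if `HasUniqueHeatSolution Ω`. -/
noncomputable def heatSolution (Ω : Set Plane) : ℝ → L2Fun Ω :=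
  Classical.epsilon (IsHeatSolution Ω)

/-- The heat content `Q_Ω(t) = ∫_Ω u(x; t) dx`, for `t > 0`. -/
noncomputable def heatContent (Ω : Set Plane) (t : ℝ) : ℝ :=
  ∫ x in Ω, heatSolution Ω t x

/-- `Ω₁` and `Ω₂` have the same heat content at all positive times. -/
def Isoheat (Ω₁ Ω₂ : Set Plane) : Prop :=
  ∀ t : ℝ, 0 < t → heatContent Ω₁ t = heatContent Ω₂ t

/-- `S` is an open rectangle in the plane with edge lengths `a` and `b`, in any position. -/
def IsOpenRectangle (a b : ℝ) (S : Set Plane) : Prop :=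
  0 < a ∧ 0 < b ∧ ∃ e : Plane ≃ᵃⁱ[ℝ] Plane,
    S = e '' {x : Plane | 0 < x 0 ∧ x 0 < a ∧ 0 < x 1 ∧ x 1 < b}

/-- `S` is an open right isosceles triangle in the plane with legs of length `c`, in any
position. -/
def IsOpenRightIsosceles (c : ℝ) (S : Set Plane) : Prop :=
  0 < c ∧ ∃ e : Plane ≃ᵃⁱ[ℝ] Plane,
    S = e '' {x : Plane | 0 < x 1 ∧ x 1 < x 0 ∧ x 0 < c}

/-- `C` is a disjoint union of open squares `S j` of areas `2^(-j)`, for `j = 0, 1, 2, …`, and of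
an open right isosceles triangle `T` of area `2`. -/
def IsInfiniteChapmanBandC (C : Set Plane) : Prop :=
  ∃ (S : ℕ → Set Plane) (T : Set Plane),
    (∀ j : ℕ, ∃ s : ℝ, IsOpenRectangle s s (S j) ∧ s * s = (2 : ℝ) ^ (-(j : ℝ))) ∧
    (∃ c : ℝ, IsOpenRightIsosceles c T ∧ c * c / 2 = 2) ∧
    Pairwise (fun i j => Disjoint (S i) (S j)) ∧ (∀ j, Disjoint (S j) T) ∧
    C = (⋃ j, S j) ∪ T

/-- `D` is a disjoint union of open rectangles `R j`, for `j = 0, 1, 2, …`, where `R j` has area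
`2^(1-j)` and diameter (length of the diagonal) `2^(-j/2) √5`. -/
def IsInfiniteChapmanBandD (D : Set Plane) : Prop :=
  ∃ R : ℕ → Set Plane,
    (∀ j : ℕ, ∃ a b : ℝ, IsOpenRectangle a b (R j) ∧ a * b = (2 : ℝ) ^ (1 - (j : ℝ)) ∧
      √(a ^ 2 + b ^ 2) = (2 : ℝ) ^ (-(j : ℝ) / 2) * √5) ∧
    Pairwise (fun i j => Disjoint (R i) (R j)) ∧
    D = ⋃ j, R j

/-! ### The Dirichlet Laplacian as a closed symmetric operator -/

/-! In units of `π² / 4` the eigenvalues are explicit. The square `S j` has `2^j * 4 (m² + n²)`, the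
triangle with legs 2 has `p² + q²` with `p > q ≥ 1`, and the rectangle `R j`, with edges `r` and
`2r` for `r² = 2^(-j)`, has `2^j (4 m² + n²)`; here `m, n ≥ 1`. The terms of `R j` with `n` even are
exactly the spectrum of `S j`. The terms with `n` odd, taken over all `j`, are the spectrum of the
triangle. Indeed, if `p` and `q` have opposite parity, then `p² + q²` is `4 m² + n²` with `n` odd.
If they have equal parity, then `p² + q²` is twice `((p + q)/2)² + ((p - q)/2)²`, and halving
repeatedly reaches opposite parity in a unique way. This is `spectralMap_bijective` with
`levelC_spectralMap`.

Expanding 1 in an orthonormal basis of eigenfunctions gives the heat content as a sum of `c_i² exp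
(-λ_i t)`, where `c_i` is the integral of the `i`-th eigenfunction. For both sets the lowest level 5
is simple, carried by the triangle and by `R 0` respectively, and all other levels are at least 8.
Hence the leading term has rate `5π²/4` and the remainder has rate `2π²` (`abs_heatContent_sub_le`).
The squared integrals of the two ground states are `1024/(9π⁴)` and `64 * 2/π⁴ = 1152/(9π⁴)`; they
differ, so the heat contents do too.

The analytic content is that the explicit functions really are a basis of eigenvectors of the weak
Laplacian. Membership in `H¹₀` comes from truncating small values (`mem_sobolevH10_of_contDiff`).
Completeness on rectangles comes from Stone–Weierstrass (`ae_eq_zero_of_integral_sinProd`), and on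
the triangle from antisymmetric reflection into a square (`isEigenSystem_openTri`). The components
are glued by `exists_hilbertBasis_iUnion`. -/

theorem gradient_add_of_contDiff {φ ψ : Plane → ℝ} (hφ : ContDiff ℝ ∞ φ) (hψ : ContDiff ℝ ∞ ψ) :
    gradient (φ + ψ) = gradient φ + gradient ψ := by
  funext x
  simp only [gradient, Pi.add_apply]
  rw [fderiv_add (hφ.differentiable (by simp) x) (hψ.differentiable (by simp) x), map_add]

theorem gradient_const_smul_of_contDiff {φ : Plane → ℝ} (c : ℝ) (hφ : ContDiff ℝ ∞ φ) :
    gradient (c • φ) = c • gradient φ := by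
  funext x
  simp only [gradient, Pi.smul_apply]
  rw [fderiv_const_smul (hφ.differentiable (by simp) x)]
  simp

/-- The test pairs form a linear subspace. -/
noncomputable def testSubmodule (Ω : Set Plane) : Submodule ℝ (L2Fun Ω × L2Field Ω) where
  carrier := testPairs Ω
  zero_mem' := by
    refine ⟨0, contDiff_const, HasCompactSupport.zero, by simp [tsupport], Lp.coeFn_zero _ _ _, ?_⟩
    have : gradient (0 : Plane → ℝ) = 0 := by
      funext x; simp [gradient]
    rw [this]
    exact Lp.coeFn_zero _ _ _
  add_mem' := by
    rintro p q ⟨φ, h1, h2, h3, h4, h5⟩ ⟨ψ, k1, k2, k3, k4, k5⟩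
    refine ⟨φ + ψ, h1.add k1, h2.add k2, ?_, ?_, ?_⟩
    · exact (tsupport_add φ ψ).trans (Set.union_subset h3 k3)
    · exact (Lp.coeFn_add _ _).trans (h4.add k4)
    · rw [gradient_add_of_contDiff h1 k1]
      exact (Lp.coeFn_add _ _).trans (h5.add k5)
  smul_mem' := by
    rintro c p ⟨φ, h1, h2, h3, h4, h5⟩
    refine ⟨c • φ, h1.const_smul c, h2.smul_left (f := fun _ => c), ?_, ?_, ?_⟩
    · exact (closure_mono (Function.support_const_smul_subset c φ)).trans h3
    · exact (Lp.coeFn_smul _ _).trans (h4.const_smul c)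
    · rw [gradient_const_smul_of_contDiff c h1]
      exact (Lp.coeFn_smul _ _).trans (h5.const_smul c)

/-- The Sobolev space `H¹₀` as a linear subspace. -/
noncomputable def sobolevSubmodule (Ω : Set Plane) : Submodule ℝ (L2Fun Ω × L2Field Ω) :=
  (testSubmodule Ω).topologicalClosure

/-- Both sides are continuous in `v`, so the weak equation passes from test pairs to their closure.
-/
theorem hasDirichletLaplacian_of_testPairs {Ω : Set Plane} {f h : L2Fun Ω} {g : L2Field Ω}
    (hg : (f, g) ∈ sobolevH10 Ω)
    (H : ∀ v ∈ testPairs Ω, inner ℝ g v.2 = -inner ℝ h v.1) : HasDirichletLaplacian Ω f h := by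
  refine ⟨g, hg, fun v hv => ?_⟩
  have hc : IsClosed {v : L2Fun Ω × L2Field Ω | inner ℝ g v.2 = -inner ℝ h v.1} :=
    isClosed_eq (by fun_prop) (by fun_prop)
  exact closure_minimal H hc hv

namespace HasDirichletLaplacian

variable {Ω : Set Plane}

theorem zero : HasDirichletLaplacian Ω 0 0 :=
  ⟨0, (sobolevSubmodule Ω).zero_mem, fun v _ => by simp⟩

theorem add {f h f' h' : L2Fun Ω} (H : HasDirichletLaplacian Ω f h)
    (H' : HasDirichletLaplacian Ω f' h') : HasDirichletLaplacian Ω (f + f') (h + h') := by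
  obtain ⟨g, hg, e⟩ := H
  obtain ⟨g', hg', e'⟩ := H'
  refine ⟨g + g', (sobolevSubmodule Ω).add_mem hg hg', fun v hv => ?_⟩
  rw [inner_add_left, inner_add_left, e v hv, e' v hv]; ring

theorem smul {f h : L2Fun Ω} (c : ℝ) (H : HasDirichletLaplacian Ω f h) :
    HasDirichletLaplacian Ω (c • f) (c • h) := by
  obtain ⟨g, hg, e⟩ := H
  refine ⟨c • g, (sobolevSubmodule Ω).smul_mem c hg, fun v hv => ?_⟩
  rw [inner_smul_left, inner_smul_left, e v hv]; simp

theorem sum {ι : Type*} (s : Finset ι) {f h : ι → L2Fun Ω}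
    (H : ∀ i, HasDirichletLaplacian Ω (f i) (h i)) :
    HasDirichletLaplacian Ω (∑ i ∈ s, f i) (∑ i ∈ s, h i) := by
  classical
  induction s using Finset.induction_on with
  | empty => simpa using zero
  | insert a s ha ih => rw [Finset.sum_insert ha, Finset.sum_insert ha]; exact (H a).add ih

theorem symmetric {f h f' h' : L2Fun Ω} (H : HasDirichletLaplacian Ω f h)
    (H' : HasDirichletLaplacian Ω f' h') : (inner ℝ h f' : ℝ) = inner ℝ f h' := by
  obtain ⟨g, hg, e⟩ := H
  obtain ⟨g', hg', e'⟩ := H'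
  have h1 := e _ hg'
  have h2 := e' _ hg
  simp only at h1 h2
  rw [real_inner_comm] at h2
  rw [real_inner_comm f] at h2
  linarith

end HasDirichletLaplacian

/-- The gradients are not part of the graph, so their convergence has to be recovered. Testing the
equation for a difference with the difference itself gives `‖g m - g n‖² ≤ ‖Δ-difference‖ *
‖f-difference‖`, so they form a Cauchy sequence. -/
theorem isClosed_hasDirichletLaplacian (Ω : Set Plane) :
    IsClosed {p : L2Fun Ω × L2Fun Ω | HasDirichletLaplacian Ω p.1 p.2} := by
  rw [← isSeqClosed_iff_isClosed]
  intro p q hp hq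
  choose g hg hgv using hp
  have hcau : CauchySeq p := hq.cauchySeq
  have hgc : CauchySeq g := by
    rw [Metric.cauchySeq_iff] at hcau ⊢
    intro ε hε
    obtain ⟨N, hN⟩ := hcau ε hε
    refine ⟨N, fun m hm n hn => ?_⟩
    have hd := hN m hm n hn
    rw [dist_eq_norm] at hd ⊢
    have h1 : ‖(p m).1 - (p n).1‖ < ε := (norm_fst_le (p m - p n)).trans_lt hd
    have h2 : ‖(p m).2 - (p n).2‖ < ε := (norm_snd_le (p m - p n)).trans_lt hd
    have hmem : ((p m).1 - (p n).1, g m - g n) ∈ sobolevH10 Ω :=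
      (sobolevSubmodule Ω).sub_mem (hg m) (hg n)
    have e1 := hgv m _ hmem
    have e2 := hgv n _ hmem
    simp only at e1 e2
    have e3 : (inner ℝ (g m - g n) (g m - g n) : ℝ)
        = -inner ℝ ((p m).2 - (p n).2) ((p m).1 - (p n).1) := by
      rw [inner_sub_left, e1, e2, inner_sub_left]; ring
    rw [real_inner_self_eq_norm_sq] at e3
    have e4 := abs_real_inner_le_norm ((p m).2 - (p n).2) ((p m).1 - (p n).1)
    have e5 := neg_abs_le (inner ℝ ((p m).2 - (p n).2) ((p m).1 - (p n).1) : ℝ)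
    have e6 : ‖(p m).2 - (p n).2‖ * ‖(p m).1 - (p n).1‖ < ε * ε :=
      mul_lt_mul'' h2 h1 (norm_nonneg _) (norm_nonneg _)
    nlinarith [norm_nonneg (g m - g n)]
  obtain ⟨G, hG⟩ := cauchySeq_tendsto_of_complete hgc
  have hq1 : Tendsto (fun n => (p n).1) atTop (𝓝 q.1) := (continuous_fst.tendsto q).comp hq
  have hq2 : Tendsto (fun n => (p n).2) atTop (𝓝 q.2) := (continuous_snd.tendsto q).comp hq
  refine ⟨G, ?_, fun v hv => ?_⟩
  · exact (isClosed_closure (s := testPairs Ω)).mem_of_tendsto (hq1.prodMk_nhds hG)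
      (Eventually.of_forall hg)
  · have t1 : Tendsto (fun n => (inner ℝ (g n) v.2 : ℝ)) atTop (𝓝 (inner ℝ G v.2)) :=
      hG.inner tendsto_const_nhds
    have t2 : Tendsto (fun n => -(inner ℝ (p n).2 v.1 : ℝ)) atTop (𝓝 (-inner ℝ q.2 v.1)) :=
      (hq2.inner tendsto_const_nhds).neg
    exact tendsto_nhds_unique t1 (t2.congr fun n => (hgv n v hv).symm)

/-- The partial sums of the two expansions lie in the graph by linearity, and the graph is closed.
-/
theorem hasDirichletLaplacian_of_repr {Ω : Set Plane} {ι : Type*} (b : HilbertBasis ι ℝ (L2Fun Ω))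
    {ev : ι → ℝ} (hb : ∀ i, HasDirichletLaplacian Ω (b i) (-(ev i • b i))) {f h : L2Fun Ω}
    (hfh : ∀ i, b.repr h i = -(ev i * b.repr f i)) : HasDirichletLaplacian Ω f h := by
  have hs := (b.hasSum_repr f).prodMk (b.hasSum_repr h)
  refine (isClosed_hasDirichletLaplacian Ω).mem_of_tendsto hs (Eventually.of_forall fun s => ?_)
  have : HasDirichletLaplacian Ω (∑ i ∈ s, b.repr f i • b i) (∑ i ∈ s, b.repr h i • b i) := by
    refine HasDirichletLaplacian.sum s fun i => ?_
    have := (hb i).smul (b.repr f i)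
    rwa [smul_neg, smul_smul, ← neg_smul, mul_comm, ← hfh i] at this
  simpa [Prod.fst_sum, Prod.snd_sum] using this

/-! ### Multipliers of a Hilbert basis -/

section Multiplier

variable {ι E : Type*} [NormedAddCommGroup E] [InnerProductSpace ℝ E] (b : HilbertBasis ι ℝ E)

theorem HilbertBasis.hasSum_sq_repr (f : E) : HasSum (fun i => b.repr f i ^ 2) (‖f‖ ^ 2) := by
  have := b.hasSum_inner_mul_inner f f
  rw [real_inner_self_eq_norm_sq] at this
  have e : (fun i => b.repr f i ^ 2) = fun i => inner ℝ f (b i) * inner ℝ (b i) f := by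
    funext i
    rw [b.repr_apply_apply, real_inner_comm f, sq]
  rwa [e]

theorem HilbertBasis.norm_le_of_repr_le {f g : E} {K : ℝ} (hK : 0 ≤ K)
    (h : ∀ i, |b.repr g i| ≤ K * |b.repr f i|) : ‖g‖ ≤ K * ‖f‖ := by
  have h1 := b.hasSum_sq_repr g
  have h2 := (b.hasSum_sq_repr f).mul_left (K ^ 2)
  have h3 : ‖g‖ ^ 2 ≤ K ^ 2 * ‖f‖ ^ 2 := by
    refine hasSum_le (fun i => ?_) h1 h2
    have := pow_le_pow_left₀ (abs_nonneg _) (h i) 2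
    rwa [mul_pow, sq_abs, sq_abs] at this
  rw [← mul_pow] at h3
  exact le_of_sq_le_sq h3 (by positivity)

theorem HilbertBasis.exists_repr_eq_mul {a : ι → ℝ} {K : ℝ} (h : ∀ i, |a i| ≤ K) (f : E) :
    ∃ g : E, ∀ i, b.repr g i = a i * b.repr f i := by
  have hm : Memℓp (fun i => a i * b.repr f i) 2 := by
    apply memℓp_gen
    have hs : Summable fun i => K ^ 2 * b.repr f i ^ 2 := (b.hasSum_sq_repr f).summable.mul_left _
    refine Summable.of_nonneg_of_le (fun i => by positivity) (fun i => ?_) hs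
    simp only [ENNReal.toReal_ofNat, Real.rpow_ofNat, Real.norm_eq_abs, sq_abs, mul_pow]
    gcongr ?_ * _
    rw [← sq_abs (a i)]
    exact pow_le_pow_left₀ (abs_nonneg _) (h i) 2
  exact ⟨b.repr.symm ⟨_, hm⟩, fun i => by simp⟩

end Multiplier

/-! ### The heat problem in terms of a basis of eigenfunctions -/

theorem Real.abs_exp_sub_one_sub_id_le_mul_exp (x : ℝ) :
    |Real.exp x - 1 - x| ≤ x ^ 2 * Real.exp |x| := by
  have h := Complex.norm_exp_sub_sum_le_norm_mul_exp (x : ℂ) 2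
  simp only [Finset.sum_range_succ, Finset.range_zero, Finset.sum_empty, pow_zero, pow_one,
    Nat.factorial_zero, Nat.factorial_one, Nat.cast_one, div_one, zero_add] at h
  have e : Complex.exp (x : ℂ) - (1 + (x : ℂ)) = ((Real.exp x - 1 - x : ℝ) : ℂ) := by
    push_cast; ring
  rw [e, Complex.norm_real, Complex.norm_real, Real.norm_eq_abs, Real.norm_eq_abs, sq_abs] at h
  exact h

/-- The bound does not depend on `ev`. This uniformity lets the heat series be differentiated in the
`L²` norm, although the eigenvalues are unbounded. -/
theorem abs_exp_neg_mul_taylor_le {ev s t : ℝ} (hev : 0 ≤ ev) (ht : 0 < t) (hs : |s - t| ≤ t / 2) :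
    |Real.exp (-(ev * s)) - Real.exp (-(ev * t)) + (s - t) * (ev * Real.exp (-(ev * t)))|
      ≤ 8 / t ^ 2 * (s - t) ^ 2 := by
  have h1 : Real.exp (-(ev * s)) = Real.exp (-(ev * t)) * Real.exp (-(ev * (s - t))) := by
    rw [← Real.exp_add]; congr 1; ring
  have h2 : Real.exp (-(ev * s)) - Real.exp (-(ev * t)) + (s - t) * (ev * Real.exp (-(ev * t)))
      = Real.exp (-(ev * t)) * (Real.exp (-(ev * (s - t))) - 1 - -(ev * (s - t))) := by
    rw [h1]; ring
  rw [h2, abs_mul, abs_of_pos (Real.exp_pos _)]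
  have h3 := Real.abs_exp_sub_one_sub_id_le_mul_exp (-(ev * (s - t)))
  have h4 : |-(ev * (s - t))| ≤ ev * t / 2 := by
    rw [abs_neg, abs_mul, abs_of_nonneg hev, mul_div_assoc]
    exact mul_le_mul_of_nonneg_left hs hev
  have h5 : Real.exp (|-(ev * (s - t))|) ≤ Real.exp (ev * t / 2) := Real.exp_le_exp.2 h4
  have h6 : Real.exp (-(ev * t)) * Real.exp (ev * t / 2) = Real.exp (-(ev * t / 2)) := by
    rw [← Real.exp_add]; congr 1; ring
  -- This is `x² / 2 ≤ exp x` at `x = ev * t / 2`.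
  have h7 : ev ^ 2 * Real.exp (-(ev * t / 2)) ≤ 8 / t ^ 2 := by
    have := Real.quadratic_le_exp_of_nonneg (x := ev * t / 2) (by positivity)
    rw [Real.exp_neg, ← div_eq_mul_inv, div_le_div_iff₀ (Real.exp_pos _) (by positivity)]
    nlinarith [mul_nonneg hev ht.le]
  calc Real.exp (-(ev * t)) * |Real.exp (-(ev * (s - t))) - 1 - -(ev * (s - t))|
      ≤ Real.exp (-(ev * t)) * ((-(ev * (s - t))) ^ 2 * Real.exp (ev * t / 2)) := by
        gcongr
        exact h3.trans (by gcongr)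
    _ = ev ^ 2 * Real.exp (-(ev * t / 2)) * (s - t) ^ 2 := by rw [← h6]; ring
    _ ≤ _ := by gcongr

theorem mul_exp_neg_mul_le {ev t : ℝ} (ht : 0 < t) : ev * Real.exp (-(ev * t)) ≤ 1 / t := by
  rw [Real.exp_neg, ← div_eq_mul_inv, div_le_div_iff₀ (Real.exp_pos _) ht]
  linarith [Real.add_one_le_exp (ev * t)]

section Heat

variable {Ω : Set Plane} {ι : Type*}

/-- The constant function `1` in `L²(Ω)`. -/
noncomputable def oneL2 (Ω : Set Plane) [IsFiniteMeasure ((volume : Measure Plane).restrict Ω)] :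
    L2Fun Ω :=
  (memLp_const (1 : ℝ) : MemLp (fun _ : Plane => (1 : ℝ)) 2 (volume.restrict Ω)).toLp _

theorem inner_oneL2 [IsFiniteMeasure ((volume : Measure Plane).restrict Ω)] (f : L2Fun Ω) :
    inner ℝ (oneL2 Ω) f = ∫ x in Ω, f x := by
  rw [L2.inner_def]
  refine integral_congr_ae ?_
  have : (oneL2 Ω : Plane → ℝ) =ᵐ[volume.restrict Ω] fun _ => 1 := MemLp.coeFn_toLp _
  filter_upwards [this] with x hx
  simp [hx]

theorem tendsto_oneL2_iff [IsFiniteMeasure ((volume : Measure Plane).restrict Ω)]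
    {u : ℝ → L2Fun Ω} {l : Filter ℝ} :
    Tendsto (fun t : ℝ => eLpNorm (fun x => u t x - 1) 2 (volume.restrict Ω)) l (𝓝 0) ↔
      Tendsto u l (𝓝 (oneL2 Ω)) :=
  (Lp.tendsto_Lp_iff_tendsto_eLpNorm u (fun _ => (1 : ℝ)) (memLp_const 1)).symm

variable (b : HilbertBasis ι ℝ (L2Fun Ω)) {ev : ι → ℝ}

theorem HilbertBasis.ext_repr {f g : L2Fun Ω} (h : ∀ i, b.repr f i = b.repr g i) : f = g :=
  b.repr.injective (lp.ext (funext h))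

/-- By symmetry of the Laplacian, `exp (ev i * s) * ⟪b i, u s⟫` has derivative zero for `s > 0`. It
is therefore constant, and the initial condition gives its value. Uniqueness of the heat problem
follows. -/
theorem repr_eq_of_isHeatSolution [IsFiniteMeasure ((volume : Measure Plane).restrict Ω)]
    (hb : ∀ i, HasDirichletLaplacian Ω (b i) (-(ev i • b i))) {u : ℝ → L2Fun Ω}
    (hu : IsHeatSolution Ω u) {t : ℝ} (ht : 0 < t) (i : ι) :
    b.repr (u t) i = Real.exp (-(ev i * t)) * b.repr (oneL2 Ω) i := by
  obtain ⟨h1, h2⟩ := hu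
  rw [tendsto_oneL2_iff] at h2
  set y : ℝ → ℝ := fun s => Real.exp (ev i * s) * inner ℝ (b i) (u s) with hy
  have hd : ∀ s ∈ Set.Ioi (0 : ℝ), HasDerivAt y 0 s := by
    intro s hs
    obtain ⟨h, hh, hder⟩ := h1 s hs
    have e1 : (inner ℝ (b i) h : ℝ) = -(ev i * inner ℝ (b i) (u s)) := by
      rw [real_inner_comm, hh.symmetric (hb i), inner_neg_right, inner_smul_right, real_inner_comm]
    have e2 : HasDerivAt (fun s => (inner ℝ (b i) (u s) : ℝ)) (inner ℝ (b i) h) s := by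
      simpa using (hasDerivAt_const s (b i)).inner ℝ hder
    have e3 : HasDerivAt (fun s => Real.exp (ev i * s)) (Real.exp (ev i * s) * ev i) s := by
      simpa using ((hasDerivAt_id s).const_mul (ev i)).exp
    have := e3.mul e2
    rw [e1] at this
    have e0 : Real.exp (ev i * s) * ev i * inner ℝ (b i) (u s)
        + Real.exp (ev i * s) * -(ev i * inner ℝ (b i) (u s)) = 0 := by ring
    rwa [e0] at this
  have hconst : ∀ s ∈ Set.Ioi (0 : ℝ), y s = y t := by
    obtain ⟨a, ha⟩ := isOpen_Ioi.exists_is_const_of_deriv_eq_zero isPreconnected_Ioi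
      (fun s hs => (hd s hs).differentiableAt.differentiableWithinAt)
      (fun s hs => (hd s hs).deriv)
    intro s hs
    rw [ha s hs, ha t ht]
  have hlim : Tendsto y (𝓝[>] 0) (𝓝 (Real.exp (ev i * 0) * inner ℝ (b i) (oneL2 Ω))) := by
    refine Tendsto.mul ?_ (tendsto_const_nhds.inner h2)
    exact (Continuous.tendsto (by fun_prop) 0).mono_left nhdsWithin_le_nhds
  have hlim' : Tendsto y (𝓝[>] 0) (𝓝 (y t)) :=
    tendsto_const_nhds.congr' (eventually_nhdsWithin_of_forall fun s hs => (hconst s hs).symm)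
  have := tendsto_nhds_unique hlim' hlim
  rw [b.repr_apply_apply, b.repr_apply_apply]
  simp only [hy, mul_zero, Real.exp_zero, one_mul] at this
  rw [← this, ← mul_assoc, ← Real.exp_add]
  simp

/-- The candidate for the time derivative has coefficients `-ev i * exp (-(ev i * t))` times those
of 1, a bounded multiplier for fixed `t > 0`. The uniform Taylor estimate makes the difference
quotient converge in norm. The limit at time zero is dominated convergence in Parseval's sum. -/
theorem isHeatSolution_of_repr [IsFiniteMeasure ((volume : Measure Plane).restrict Ω)]
    (hev : ∀ i, 0 ≤ ev i) (hb : ∀ i, HasDirichletLaplacian Ω (b i) (-(ev i • b i)))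
    {u : ℝ → L2Fun Ω}
    (hu : ∀ t : ℝ, 0 < t → ∀ i, b.repr (u t) i = Real.exp (-(ev i * t)) * b.repr (oneL2 Ω) i) :
    IsHeatSolution Ω u := by
  refine ⟨fun t ht => ?_, ?_⟩
  · have hK : ∀ i, |-(ev i * Real.exp (-(ev i * t)))| ≤ 1 / t := fun i => by
      rw [abs_neg, abs_of_nonneg (mul_nonneg (hev i) (Real.exp_pos _).le)]
      exact mul_exp_neg_mul_le ht
    obtain ⟨h, hh⟩ := b.exists_repr_eq_mul hK (oneL2 Ω)
    refine ⟨h, hasDirichletLaplacian_of_repr b hb fun i => ?_, ?_⟩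
    · rw [hh, hu t ht]; ring
    · rw [hasDerivAt_iff_isLittleO]
      have hO : (fun s => u s - u t - (s - t) • h) =O[𝓝 t] fun s => (s - t) ^ 2 := by
        refine IsBigO.of_bound (8 / t ^ 2 * ‖oneL2 Ω‖) ?_
        have hn : ∀ᶠ s in 𝓝 t, |s - t| < t / 2 := by
          have := Metric.ball_mem_nhds t (half_pos ht)
          filter_upwards [this] with s hs
          rwa [Metric.mem_ball, Real.dist_eq] at hs
        filter_upwards [hn] with s hs
        have hs0 : 0 < s := by have := (abs_lt.1 hs).1; linarith
        rw [Real.norm_eq_abs, abs_of_nonneg (sq_nonneg (s - t))]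
        have := b.norm_le_of_repr_le (f := oneL2 Ω) (g := u s - u t - (s - t) • h)
          (K := 8 / t ^ 2 * (s - t) ^ 2) (by positivity) fun i => by
            have e : b.repr (u s - u t - (s - t) • h) i = (Real.exp (-(ev i * s))
                - Real.exp (-(ev i * t)) + (s - t) * (ev i * Real.exp (-(ev i * t))))
                * b.repr (oneL2 Ω) i := by
              simp only [map_sub, map_smul, lp.coeFn_sub, lp.coeFn_smul, Pi.sub_apply,
                Pi.smul_apply, smul_eq_mul, hh, hu t ht, hu s hs0]
              ring
            rw [e, abs_mul]
            exact mul_le_mul_of_nonneg_right (abs_exp_neg_mul_taylor_le (hev i) ht hs.le)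
              (abs_nonneg _)
        linarith
      refine hO.trans_isLittleO ?_
      have := (isLittleO_pow_pow (𝕜 := ℝ) (one_lt_two)).comp_tendsto
        (show Tendsto (fun s : ℝ => s - t) (𝓝 t) (𝓝 0) by
          simpa using (Continuous.tendsto (f := fun s : ℝ => s - t) (by fun_prop) t))
      simpa [Function.comp_def] using this
  · rw [tendsto_oneL2_iff, tendsto_iff_norm_sub_tendsto_zero]
    have hsq : Tendsto (fun t => ‖u t - oneL2 Ω‖ ^ 2) (𝓝[>] 0) (𝓝 0) := by
      have e : (fun t => ∑' i, ((Real.exp (-(ev i * t)) - 1) * b.repr (oneL2 Ω) i) ^ 2)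
          =ᶠ[𝓝[>] 0] fun t => ‖u t - oneL2 Ω‖ ^ 2 := by
        filter_upwards [self_mem_nhdsWithin] with t ht
        rw [← (b.hasSum_sq_repr (u t - oneL2 Ω)).tsum_eq]
        congr 1
        ext i
        simp only [map_sub, lp.coeFn_sub, Pi.sub_apply, hu t ht]
        ring
      refine Tendsto.congr' e ?_
      have := tendsto_tsum_of_dominated_convergence (𝓕 := 𝓝[>] (0 : ℝ))
        (f := fun t i => ((Real.exp (-(ev i * t)) - 1) * b.repr (oneL2 Ω) i) ^ 2)
        (g := fun _ => (0 : ℝ)) (b.hasSum_sq_repr (oneL2 Ω)).summable ?_ ?_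
      · simpa using this
      · intro i
        have : Tendsto (fun t => ((Real.exp (-(ev i * t)) - 1) * b.repr (oneL2 Ω) i) ^ 2) (𝓝 0)
            (𝓝 (((Real.exp (-(ev i * 0)) - 1) * b.repr (oneL2 Ω) i) ^ 2)) :=
          Continuous.tendsto (by fun_prop) 0
        simpa using this.mono_left nhdsWithin_le_nhds
      · filter_upwards [self_mem_nhdsWithin] with t ht i
        rw [Real.norm_eq_abs, abs_of_nonneg (sq_nonneg _), mul_pow]
        have h1 : Real.exp (-(ev i * t)) ≤ 1 :=
          Real.exp_le_one_iff.2 (by have := mul_nonneg (hev i) (le_of_lt ht); linarith)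
        have h2 := Real.exp_pos (-(ev i * t))
        have : (Real.exp (-(ev i * t)) - 1) ^ 2 ≤ 1 := by nlinarith
        nlinarith [sq_nonneg (b.repr (oneL2 Ω) i)]
    have := hsq.sqrt
    simpa [Real.sqrt_sq (norm_nonneg _)] using this

theorem hasUniqueHeatSolution_of_hilbertBasis
    [IsFiniteMeasure ((volume : Measure Plane).restrict Ω)]
    (hev : ∀ i, 0 ≤ ev i) (hb : ∀ i, HasDirichletLaplacian Ω (b i) (-(ev i • b i))) :
    HasUniqueHeatSolution Ω := by
  have hex : ∀ t : ℝ, ∃ f : L2Fun Ω, 0 < t →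
      ∀ i, b.repr f i = Real.exp (-(ev i * t)) * b.repr (oneL2 Ω) i := by
    intro t
    by_cases ht : 0 < t
    · have hK : ∀ i, |Real.exp (-(ev i * t))| ≤ 1 := fun i => by
        rw [abs_of_pos (Real.exp_pos _)]
        exact Real.exp_le_one_iff.2 (by have := mul_nonneg (hev i) ht.le; linarith)
      obtain ⟨f, hf⟩ := b.exists_repr_eq_mul hK (oneL2 Ω)
      exact ⟨f, fun _ => hf⟩
    · exact ⟨0, fun h => absurd h ht⟩
  choose u hu using hex
  refine ⟨u, isHeatSolution_of_repr b hev hb hu, fun v hv t ht => b.ext_repr fun i => ?_⟩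
  rw [repr_eq_of_isHeatSolution b hb hv ht, hu t ht]

/-- The heat content is `⟪1, u t⟫`. After the mode `i₀` is removed, every coefficient of `u t` is at
most `exp (-(ν * t))` times that of 1, so Parseval and Cauchy–Schwarz suffice. -/
theorem abs_heatContent_sub_le [IsFiniteMeasure ((volume : Measure Plane).restrict Ω)]
    (hev : ∀ i, 0 ≤ ev i) (hb : ∀ i, HasDirichletLaplacian Ω (b i) (-(ev i • b i)))
    (i₀ : ι) {ν : ℝ} (hν : ∀ i, i ≠ i₀ → ν ≤ ev i) {t : ℝ} (ht : 0 < t) :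
    |heatContent Ω t - (∫ x in Ω, b i₀ x) ^ 2 * Real.exp (-(ev i₀ * t))|
      ≤ ‖oneL2 Ω‖ ^ 2 * Real.exp (-(ν * t)) := by
  obtain ⟨u, hu, -⟩ := hasUniqueHeatSolution_of_hilbertBasis b hev hb
  have hs : IsHeatSolution Ω (heatSolution Ω) := Classical.epsilon_spec ⟨u, hu⟩
  have hr := fun i => repr_eq_of_isHeatSolution b hb hs ht i
  set c : ℝ := ∫ x in Ω, b i₀ x with hc
  have hc' : b.repr (oneL2 Ω) i₀ = c := by
    rw [b.repr_apply_apply, real_inner_comm, inner_oneL2]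
  set w : L2Fun Ω := heatSolution Ω t - (Real.exp (-(ev i₀ * t)) * c) • b i₀ with hw
  have hwn : ‖w‖ ≤ Real.exp (-(ν * t)) * ‖oneL2 Ω‖ := by
    classical
    refine b.norm_le_of_repr_le (Real.exp_pos _).le fun i => ?_
    have e : b.repr w i
        = b.repr (heatSolution Ω t) i - Real.exp (-(ev i₀ * t)) * c * b.repr (b i₀) i := by
      simp [hw]
      rfl
    rw [e, hr, b.repr_self]
    by_cases hi : i = i₀
    · subst hi
      rw [hc', lp.single_apply_self, mul_one, sub_self, abs_zero]
      positivity
    · rw [lp.single_apply_ne _ _ _ hi, mul_zero, sub_zero, abs_mul, abs_of_pos (Real.exp_pos _)]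
      gcongr
      exact hν i hi
  have hQ : heatContent Ω t - c ^ 2 * Real.exp (-(ev i₀ * t)) = inner ℝ (oneL2 Ω) w := by
    rw [hw, inner_sub_right, inner_smul_right, inner_oneL2, inner_oneL2, heatContent, ← hc]
    ring
  rw [hQ]
  calc _ ≤ ‖oneL2 Ω‖ * ‖w‖ := abs_real_inner_le_norm _ _
    _ ≤ ‖oneL2 Ω‖ * (Real.exp (-(ν * t)) * ‖oneL2 Ω‖) := by gcongr
    _ = _ := by ring

end Heat

/-! ### Monotone enumeration of discrete families -/

theorem exists_equiv_monotone {I : Type*} [Countable I] [Infinite I] (N : I → ℕ)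
    (hN : ∀ M, {i | N i ≤ M}.Finite) : ∃ σ : ℕ ≃ I, Monotone (N ∘ σ) := by
  classical
  obtain ⟨c, hc⟩ := exists_injective_nat I
  -- Ties in `N` are broken by an injection into `ℕ`. This makes a linear order with finite initial
  -- segments and no maximum, hence a copy of `ℕ`.
  let key : I → ℕ ×ₗ ℕ := fun i => toLex (N i, c i)
  have hkey : Function.Injective key := fun i j h => by
    have := congrArg (fun x => (ofLex x).2) h
    exact hc this
  let _ : LinearOrder I := LinearOrder.lift' key hkey
  have hle : ∀ i j : I, i ≤ j → N i ≤ N j := fun i j h => by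
    have h' : key i ≤ key j := h
    rcases Prod.Lex.toLex_le_toLex.1 h' with h1 | h1
    · exact h1.le
    · exact h1.1.le
  have hIic : ∀ i : I, (Set.Iic i).Finite := fun i =>
    (hN (N i)).subset fun j hj => hle j i hj
  let _ : LocallyFiniteOrder I :=
    LocallyFiniteOrder.ofFiniteIcc fun a b => (hIic b).subset fun x hx => hx.2
  obtain ⟨i₀⟩ := (inferInstance : Nonempty I)
  have hmin : ∃ m : I, ∀ i, m ≤ i := by
    obtain ⟨m, hm, hmin⟩ := Set.exists_min_image _ id (hIic i₀) ⟨i₀, le_refl i₀⟩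
    refine ⟨m, fun i => ?_⟩
    rcases le_total i i₀ with h | h
    · exact hmin i h
    · exact (show m ≤ i₀ from hm).trans h
  obtain ⟨m, hm⟩ := hmin
  let _ : OrderBot I := { bot := m, bot_le := hm }
  have : NoMaxOrder I := ⟨fun a => by
    by_contra! h
    exact Set.infinite_univ ((hIic a).subset fun x _ => h x)⟩
  let _ := LinearLocallyFiniteOrder.succOrder I
  let _ := LinearLocallyFiniteOrder.predOrder I
  let e : I ≃o ℕ := orderIsoNatOfLinearSuccPredArch
  exact ⟨e.symm.toEquiv, fun a b hab => hle _ _ (e.symm.monotone hab)⟩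

theorem tendsto_atTop_of_finite_sublevel {I : Type*} (N : I → ℕ)
    (hN : ∀ M, {i | N i ≤ M}.Finite) (σ : ℕ ≃ I) : Tendsto (N ∘ σ) atTop atTop := by
  have : Tendsto N cofinite atTop := by
    rw [tendsto_atTop]
    intro M
    rw [eventually_cofinite]
    exact (hN M).subset fun i hi => le_of_lt (not_le.1 hi)
  have hσ := σ.injective.tendsto_cofinite
  rw [Nat.cofinite_eq_atTop] at hσ
  exact this.comp hσ

/-! ### The arithmetic of the two spectra -/

/-- The eigenvalues of the set `C`, in units of `π² / 4`. -/
def levelC : Option ℕ × ℕ × ℕ → ℕ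
  | (none, q, d) => (q + 1 + (d + 1)) ^ 2 + (q + 1) ^ 2
  | (some j, m, n) => 2 ^ j * (4 * ((m + 1) ^ 2 + (n + 1) ^ 2))

/-- The eigenvalues of the set `D`, in units of `π² / 4`. -/
def levelD : ℕ × ℕ × ℕ → ℕ
  | (j, m, n) => 2 ^ j * (4 * (m + 1) ^ 2 + (n + 1) ^ 2)

/-- The pair `(q, d)` for which `{q, q + d}` is `{2 m + 2, 2 k + 1}`, shifted by one. -/
def oddPair (m k : ℕ) : ℕ × ℕ :=
  if 2 * k + 1 < 2 * m + 2 then (2 * k, 2 * m + 2 - (2 * k + 1) - 1)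
  else (2 * m + 1, 2 * k + 1 - (2 * m + 2) - 1)

/-- The map `(q, d) ↦ (d, 2 q)` on pairs of positive integers, shifted by one. -/
def doublePair (x : ℕ × ℕ) : ℕ × ℕ := (x.2, 2 * x.1 + 1)

theorem levelC_oddPair (m k : ℕ) :
    levelC (none, oddPair m k) = 4 * (m + 1) ^ 2 + (2 * k + 1) ^ 2 := by
  unfold oddPair
  split_ifs with h
  · obtain ⟨r, rfl⟩ := Nat.exists_eq_add_of_le (show k ≤ m by omega)
    have : 2 * (k + r) + 2 - (2 * k + 1) - 1 = 2 * r := by omega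
    rw [this]
    simp only [levelC]
    ring
  · obtain ⟨r, rfl⟩ := Nat.exists_eq_add_of_le (show m + 1 ≤ k by omega)
    have : 2 * (m + 1 + r) + 1 - (2 * m + 2) - 1 = 2 * r := by omega
    rw [this]
    simp only [levelC]
    ring

/-- The identity `(d + 2q)² + d² = 2 ((q + d)² + q²)`. -/
theorem levelC_doublePair (x : ℕ × ℕ) :
    levelC (none, doublePair x) = 2 * levelC (none, x) := by
  obtain ⟨q, d⟩ := x
  simp only [levelC, doublePair]
  ring

theorem levelC_iterate_doublePair (j : ℕ) (x : ℕ × ℕ) :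
    levelC (none, doublePair^[j] x) = 2 ^ j * levelC (none, x) := by
  induction j with
  | zero => simp
  | succ j ih => rw [Function.iterate_succ_apply', levelC_doublePair, ih]; ring

theorem doublePair_injective : Function.Injective doublePair := by
  rintro ⟨a, b⟩ ⟨c, d⟩ h
  simp only [doublePair, Prod.mk.injEq] at h
  ext <;> simp <;> omega

/-- Entries are shifted by one: an even second entry is an odd difference `p - q`, that is, opposite
parity. Since `doublePair` always produces an odd second entry, parity tells the two kinds of pairs
apart. -/
theorem oddPair_snd_even (m k : ℕ) : (oddPair m k).2 % 2 = 0 := by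
  unfold oddPair
  split_ifs <;> simp only <;> omega

theorem oddPair_injective {m k m' k' : ℕ} (h : oddPair m k = oddPair m' k') :
    m = m' ∧ k = k' := by
  unfold oddPair at h
  split_ifs at h <;> simp only [Prod.mk.injEq] at h <;> omega

theorem exists_oddPair {q d : ℕ} (hd : d % 2 = 0) : ∃ m k, oddPair m k = (q, d) := by
  rcases Nat.even_or_odd' q with ⟨k, rfl | rfl⟩
  · refine ⟨k + d / 2, k, ?_⟩
    unfold oddPair
    rw [if_pos (by omega)]
    ext <;> simp only <;> omega
  · refine ⟨k, k + 1 + d / 2, ?_⟩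
    unfold oddPair
    rw [if_neg (by omega)]
    ext <;> simp only <;> omega

/-- The correspondence between the eigenvalues of `D` and those of `C`. -/
def spectralMap : ℕ × ℕ × ℕ → Option ℕ × ℕ × ℕ
  | (j, m, n) => if n % 2 = 1 then (some j, m, n / 2) else (none, doublePair^[j] (oddPair m (n / 2)))

/-- Because of the shift, `n % 2 = 1` means that the true index `n + 1` is even; then `(n + 1)²` is
four times a square and the level belongs to the square `S j`. Otherwise it is `2^j` times an even
square plus an odd one, and goes to the triangle by `j` doublings. -/
theorem levelC_spectralMap (x : ℕ × ℕ × ℕ) : levelC (spectralMap x) = levelD x := by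
  obtain ⟨j, m, n⟩ := x
  simp only [spectralMap]
  split_ifs with h
  · obtain ⟨k, rfl⟩ : ∃ k, n = 2 * k + 1 := ⟨n / 2, by omega⟩
    have : (2 * k + 1) / 2 = k := by omega
    rw [this]
    simp only [levelC, levelD]
    ring
  · obtain ⟨k, rfl⟩ : ∃ k, n = 2 * k := ⟨n / 2, by omega⟩
    have : 2 * k / 2 = k := by omega
    rw [this, levelC_iterate_doublePair, levelC_oddPair]
    rfl

/-- Strip doublings from both sides at once. If one side runs out first, the parity of the second
entry gives a contradiction. -/
theorem iterate_doublePair_oddPair_injective {j j' m k m' k' : ℕ}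
    (h : doublePair^[j] (oddPair m k) = doublePair^[j'] (oddPair m' k')) :
    j = j' ∧ m = m' ∧ k = k' := by
  induction j generalizing j' with
  | zero =>
    cases j' with
    | zero => exact ⟨rfl, oddPair_injective h⟩
    | succ j' =>
      exfalso
      rw [Function.iterate_succ_apply', Function.iterate_zero_apply] at h
      have h1 := oddPair_snd_even m k
      rw [h] at h1
      simp only [doublePair] at h1
      omega
  | succ j ih =>
    cases j' with
    | zero =>
      exfalso
      rw [Function.iterate_succ_apply', Function.iterate_zero_apply] at h
      have h1 := oddPair_snd_even m' k'
      rw [← h] at h1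
      simp only [doublePair] at h1
      omega
    | succ j' =>
      rw [Function.iterate_succ_apply', Function.iterate_succ_apply'] at h
      obtain ⟨h1, h2⟩ := ih (doublePair_injective h)
      exact ⟨by rw [h1], h2⟩

/-- Descent: a pair `p, q` of equal parity is the double of a pair of half the level, so strong
induction on the level ends at opposite parity. -/
theorem exists_iterate_doublePair_oddPair (x : ℕ × ℕ) :
    ∃ j m k, doublePair^[j] (oddPair m k) = x := by
  induction hs : levelC (none, x) using Nat.strong_induction_on generalizing x with
  | _ s ih =>
    obtain ⟨q, d⟩ := x
    rcases Nat.mod_two_eq_zero_or_one d with hd | hd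
    · obtain ⟨m, k, h⟩ := exists_oddPair (q := q) hd
      exact ⟨0, m, k, h⟩
    · have hx : doublePair (d / 2, q) = (q, d) := by
        ext <;> simp only [doublePair]; omega
      have hl := levelC_doublePair (d / 2, q)
      rw [hx, hs] at hl
      have hpos : 0 < levelC (none, d / 2, q) := by simp only [levelC]; positivity
      obtain ⟨j, m, k, h⟩ := ih _ (by omega) (d / 2, q) rfl
      refine ⟨j + 1, m, k, ?_⟩
      rw [Function.iterate_succ_apply', h, hx]

theorem spectralMap_bijective : Function.Bijective spectralMap := by
  constructor
  · rintro ⟨j, m, n⟩ ⟨j', m', n'⟩ h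
    simp only [spectralMap] at h
    split_ifs at h with h1 h2 h2
    · simp only [Prod.mk.injEq, Option.some.injEq] at h ⊢
      omega
    · simp at h
    · simp at h
    · simp only [Prod.mk.injEq, true_and] at h ⊢
      have := iterate_doublePair_oddPair_injective h
      omega
  · rintro ⟨_ | j, x⟩
    · obtain ⟨j, m, k, h⟩ := exists_iterate_doublePair_oddPair x
      refine ⟨(j, m, 2 * k), ?_⟩
      simp only [spectralMap]
      rw [if_neg (by omega), show 2 * k / 2 = k by omega, h]
    · obtain ⟨m, n⟩ := x
      refine ⟨(j, m, 2 * n + 1), ?_⟩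
      simp only [spectralMap]
      rw [if_pos (by omega), show (2 * n + 1) / 2 = n by omega]

/-! ### Finiteness of the sublevel sets, and the gap above the ground level. -/

theorem sq_add_one_ge {a n : ℕ} (h : a ≤ n) : (a + 1) ^ 2 ≤ (n + 1) ^ 2 :=
  Nat.pow_le_pow_left (by omega) 2

theorem finite_levelD_le (M : ℕ) : {x | levelD x ≤ M}.Finite := by
  refine ((Set.finite_Iic M).prod ((Set.finite_Iic M).prod (Set.finite_Iic M))).subset ?_
  rintro ⟨j, m, n⟩ (h : 2 ^ j * (4 * (m + 1) ^ 2 + (n + 1) ^ 2) ≤ M)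
  have h1 : j < 2 ^ j := Nat.lt_two_pow_self
  have h2 : 1 ≤ 2 ^ j := Nat.one_le_two_pow
  have h3 : m + n + 1 ≤ 4 * (m + 1) ^ 2 + (n + 1) ^ 2 := by nlinarith
  have h4 := Nat.mul_le_mul h2 (le_refl (4 * (m + 1) ^ 2 + (n + 1) ^ 2))
  have h5 := Nat.mul_le_mul (le_refl (2 ^ j)) (show 1 ≤ 4 * (m + 1) ^ 2 + (n + 1) ^ 2 by omega)
  simp only [Set.mem_prod, Set.mem_Iic]
  refine ⟨?_, ?_, ?_⟩ <;> linarith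

/-- The ground level is 5. The bound 8, in units of `π² / 4`, is the rate `2π²` of the error term.
-/
theorem levelD_ge_eight {x : ℕ × ℕ × ℕ} (hx : x ≠ (0, 0, 0)) : 8 ≤ levelD x := by
  obtain ⟨j, m, n⟩ := x
  simp only [levelD]
  have hm := sq_add_one_ge (Nat.zero_le m)
  have hn := sq_add_one_ge (Nat.zero_le n)
  rcases j with _ | j
  · rcases m with _ | m
    · rcases n with _ | n
      · exact absurd rfl hx
      · have := sq_add_one_ge (show 1 ≤ n + 1 by omega)
        linarith
    · have := sq_add_one_ge (show 1 ≤ m + 1 by omega)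
      linarith
  · have h2 : 1 ≤ 2 ^ j := Nat.one_le_two_pow
    have h4 := Nat.mul_le_mul h2 (show 5 ≤ 4 * (m + 1) ^ 2 + (n + 1) ^ 2 by linarith)
    rw [pow_succ]
    linarith

theorem levelC_ge_eight {x : Option ℕ × ℕ × ℕ} (hx : x ≠ (none, 0, 0)) : 8 ≤ levelC x := by
  obtain ⟨_ | j, q, d⟩ := x
  · simp only [levelC]
    rcases q with _ | q
    · rcases d with _ | d
      · exact absurd rfl hx
      · have := Nat.pow_le_pow_left (show 3 ≤ 0 + 1 + (d + 1 + 1) by omega) 2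
        linarith
    · have h1 := Nat.pow_le_pow_left (show 2 ≤ q + 1 + 1 + (d + 1) by omega) 2
      have h2 := Nat.pow_le_pow_left (show 2 ≤ q + 1 + 1 by omega) 2
      linarith
  · simp only [levelC]
    have h1 := sq_add_one_ge (Nat.zero_le q)
    have h2 := sq_add_one_ge (Nat.zero_le d)
    have h3 : 1 ≤ 2 ^ j := Nat.one_le_two_pow
    have h4 := Nat.mul_le_mul h3 (show 8 ≤ 4 * ((q + 1) ^ 2 + (d + 1) ^ 2) by linarith)
    linarith

/-! ### Smooth functions vanishing on the boundary belong to `H¹₀` -/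

theorem tendsto_eLpNorm_two_of_dominated {α E : Type*} [MeasurableSpace α] {μ : Measure α}
    [NormedAddCommGroup E] {F : ℕ → α → E} {f : α → E} {g : α → ℝ} (hg : MemLp g 2 μ)
    (hF : ∀ n, AEStronglyMeasurable (F n) μ) (hf : AEStronglyMeasurable f μ)
    (hb : ∀ n, ∀ᵐ x ∂μ, ‖F n x - f x‖ ≤ g x)
    (hlim : ∀ᵐ x ∂μ, Tendsto (fun n => F n x) atTop (𝓝 (f x))) :
    Tendsto (fun n => eLpNorm (F n - f) 2 μ) atTop (𝓝 0) := by
  have hI : Tendsto (fun n => ∫⁻ x, ‖F n x - f x‖ₑ ^ (2 : ℝ) ∂μ) atTop (𝓝 (∫⁻ _, 0 ∂μ)) := by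
    refine tendsto_lintegral_of_dominated_convergence' (fun x => ‖g x‖ₑ ^ (2 : ℝ)) ?_ ?_ ?_ ?_
    · intro n
      exact ((hF n).sub hf).enorm.pow_const _
    · intro n
      filter_upwards [hb n] with x hx
      refine ENNReal.rpow_le_rpow ?_ (by norm_num)
      rw [enorm_le_iff_norm_le]
      exact hx.trans (le_abs_self _)
    · have := lintegral_rpow_enorm_lt_top_of_eLpNorm_lt_top (p := 2) (by simp) (by simp)
        hg.eLpNorm_lt_top
      simpa using this.ne
    · filter_upwards [hlim] with x hx
      have h1 : Tendsto (fun n => ‖F n x - f x‖ₑ) atTop (𝓝 0) := by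
        have := (hx.sub_const (f x)).enorm
        simpa using this
      have := (ENNReal.continuous_rpow_const (y := 2)).tendsto 0 |>.comp h1
      simpa [Function.comp_def] using this
  have h2 := (ENNReal.continuous_rpow_const (y := 1 / 2)).tendsto (∫⁻ _, 0 ∂μ) |>.comp hI
  simp only [lintegral_zero] at h2
  rw [ENNReal.zero_rpow_of_pos (by norm_num)] at h2
  refine h2.congr fun n => ?_
  rw [eLpNorm_eq_lintegral_rpow_enorm_toReal (by simp) (by simp)]
  simp

theorem continuous_gradient {φ : Plane → ℝ} (hφ : ContDiff ℝ ∞ φ) : Continuous (gradient φ) :=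
  (InnerProductSpace.toDual ℝ Plane).symm.continuous.comp (hφ.continuous_fderiv (by simp))

/-- Almost every point of the zero set is a density point of it, and there the derivative is
determined by the values on the set, so it vanishes. -/
theorem ae_gradient_eq_zero_of_eq_zero {φ : Plane → ℝ} (hφ : ContDiff ℝ ∞ φ) :
    ∀ᵐ x : Plane, φ x = 0 → gradient φ x = 0 := by
  set v : Plane := EuclideanSpace.single 0 1 with hv
  set s : Set Plane := {x | φ x = 0} with hs
  have hsm : MeasurableSet s := (isClosed_eq hφ.continuous continuous_const).measurableSet
  -- The density-point argument is available for maps of the plane into itself, so `φ` is multiplied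
  -- by a fixed vector. On the zero set this map is constant, hence approximated by 0 with error 0.
  have hap : ApproximatesLinearOn (fun x => φ x • v) (0 : Plane →L[ℝ] Plane) s 0 := by
    intro x hx y hy
    have hx' : φ x = 0 := hx
    have hy' : φ y = 0 := hy
    simp [hx', hy']
  have key := hap.norm_fderiv_sub_le volume hsm (fun x => (fderiv ℝ φ x).smulRight v)
    fun x _ => (((hφ.differentiable (by simp) x).hasFDerivAt).smul_const v).hasFDerivWithinAt
  rw [ae_restrict_iff' hsm] at key
  filter_upwards [key] with x hx h0
  have h1 := hx h0
  have h2 : ContinuousLinearMap.smulRight (fderiv ℝ φ x) v = 0 := by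
    rw [← norm_le_zero_iff]
    simpa using NNReal.coe_le_coe.2 h1
  have h3 : fderiv ℝ φ x = 0 := by
    ext w
    have := congrArg (fun L : Plane →L[ℝ] Plane => L w 0) h2
    simpa [hv] using this
  simp [gradient, h3]

/-- The open sets `U` and `Kᶜ` cover the plane; the cut-off function equals `ψ` on the first and 0
on the second. -/
theorem contDiff_indicator_of_subset {U K : Set Plane} (hU : IsOpen U) (hK : IsClosed K)
    (hKU : K ⊆ U) {ψ : Plane → ℝ} (hψ : ContDiff ℝ ∞ ψ) (h0 : ∀ x ∈ U, x ∉ K → ψ x = 0) :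
    ContDiff ℝ ∞ (U.indicator ψ) ∧ tsupport (U.indicator ψ) ⊆ K ∧
      gradient (U.indicator ψ) = U.indicator (gradient ψ) := by
  have hout : ∀ x ∉ K, U.indicator ψ x = 0 := fun x hx => by
    by_cases hxU : x ∈ U
    · rw [Set.indicator_of_mem hxU, h0 x hxU hx]
    · exact Set.indicator_of_notMem hxU _
  have hin : ∀ x ∈ U, U.indicator ψ =ᶠ[𝓝 x] ψ := fun x hx =>
    (Set.eqOn_indicator (f := ψ)).eventuallyEq_of_mem (hU.mem_nhds hx)
  have hout' : ∀ x ∉ U, U.indicator ψ =ᶠ[𝓝 x] fun _ => 0 := fun x hx => by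
    filter_upwards [hK.isOpen_compl.mem_nhds (fun h => hx (hKU h) : x ∈ Kᶜ)] with y hy
    exact hout y hy
  refine ⟨?_, ?_, ?_⟩
  · rw [contDiff_iff_contDiffAt]
    intro x
    by_cases hx : x ∈ U
    · exact hψ.contDiffAt.congr_of_eventuallyEq (hin x hx)
    · exact contDiffAt_const.congr_of_eventuallyEq (hout' x hx)
  · refine closure_minimal (fun x hx => ?_) hK
    by_contra h
    exact hx (hout x h)
  · funext x
    by_cases hx : x ∈ U
    · rw [Set.indicator_of_mem hx, (hin x hx).gradient_eq]
    · rw [Set.indicator_of_notMem hx, (hout' x hx).gradient_eq]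
      exact gradient_fun_const x 0

/-- A smooth truncation profile: `H x = x` near `0`, and `H` has compact support. -/
theorem exists_truncation : ∃ H : ℝ → ℝ, ContDiff ℝ ∞ H ∧ (∀ x, |x| ≤ 1 → H x = x) ∧
    (∀ x, 2 < |x| → H x = 0 ∧ deriv H x = 0) ∧ ∃ C, ∀ x, |H x| ≤ C ∧ |deriv H x| ≤ C := by
  let χ : ContDiffBump (0 : ℝ) := ⟨1, 2, by norm_num, by norm_num⟩
  have hsmooth : ContDiff ℝ ∞ fun x : ℝ => x * χ x := contDiff_id.mul χ.contDiff
  have hcs : HasCompactSupport fun x : ℝ => x * χ x := χ.hasCompactSupport.mul_left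
  refine ⟨fun x => x * χ x, hsmooth, fun x hx => ?_, fun x hx => ?_, ?_⟩
  · have : χ x = 1 := χ.one_of_mem_closedBall (by simpa [χ] using hx)
    simp [this]
  · have hev : (fun x : ℝ => x * χ x) =ᶠ[𝓝 x] fun _ => 0 := by
      have : {y : ℝ | 2 < |y|} ∈ 𝓝 x := (isOpen_lt continuous_const continuous_abs).mem_nhds hx
      filter_upwards [this] with y hy
      have : χ y = 0 := χ.zero_of_le_dist (by simpa [χ] using le_of_lt hy)
      simp [this]
    exact ⟨hev.self_of_nhds, by rw [hev.deriv_eq]; simp⟩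
  · obtain ⟨C, hC⟩ := hsmooth.continuous.bounded_above_of_compact_support hcs
    obtain ⟨C', hC'⟩ := (hsmooth.continuous_deriv (by simp)).bounded_above_of_compact_support
      hcs.deriv
    exact ⟨max C C', fun x => ⟨(hC x).trans (le_max_left _ _), (hC' x).trans (le_max_right _ _)⟩⟩

/-- No regularity of the boundary is needed. The functions `φ - H (r φ) / r` vanish where `|φ| ≤
1/r`, hence near the frontier, and approximate `φ` uniformly as `r → ∞`. Their gradients `(1 - H' (r
φ)) ∇φ` are bounded on `U` and converge to `∇φ` wherever `φ ≠ 0`; where `φ = 0`, `∇φ` vanishes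
almost everywhere. -/
theorem mem_sobolevH10_of_contDiff {U Ω : Set Plane} (hU : IsOpen U)
    (hb : Bornology.IsBounded U) (hUΩ : U ⊆ Ω) {φ : Plane → ℝ} (hφ : ContDiff ℝ ∞ φ)
    (h0 : ∀ x ∈ frontier U, φ x = 0) {f : L2Fun Ω} {g : L2Field Ω}
    (hf : f =ᵐ[volume.restrict Ω] U.indicator φ)
    (hg : g =ᵐ[volume.restrict Ω] U.indicator (gradient φ)) : (f, g) ∈ sobolevH10 Ω := by
  obtain ⟨H, hH, hH1, hH2, C, hC⟩ := exists_truncation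
  have hC0 : 0 ≤ C := (abs_nonneg _).trans (hC 0).1
  have hUc : IsCompact (closure U) := hb.isCompact_closure
  have hUm : MeasurableSet U := hU.measurableSet
  -- the truncations
  set r : ℕ → ℝ := fun n => n + 1 with hr
  have hr0 : ∀ n, 0 < r n := fun n => by positivity
  have hrlim : Tendsto r atTop atTop := tendsto_atTop_add_const_right _ _ tendsto_natCast_atTop_atTop
  set ψ : ℕ → Plane → ℝ := fun n x => φ x - (r n)⁻¹ * H (r n * φ x) with hψdef
  have hψ : ∀ n, ContDiff ℝ ∞ (ψ n) := fun n =>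
    hφ.sub (contDiff_const.mul (hH.comp (contDiff_const.mul hφ)))
  have hψg : ∀ n x, gradient (ψ n) x = (1 - deriv H (r n * φ x)) • gradient φ x := by
    intro n x
    have d1 : HasGradientAt φ (gradient φ x) x := (hφ.differentiable (by simp) x).hasGradientAt
    have d2 := (hH.differentiable (by simp) (r n * φ x)).hasDerivAt
    have d3 : HasFDerivAt (ψ n) _ x := d1.hasFDerivAt.sub
      ((d2.comp_hasFDerivAt x (d1.hasFDerivAt.const_mul (r n))).const_mul (r n)⁻¹)
    refine HasGradientAt.gradient ?_
    rw [hasGradientAt_iff_hasFDerivAt]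
    refine d3.congr_fderiv ?_
    rw [map_smul, sub_smul, one_smul, smul_smul, smul_smul]
    congr 2
    have := (hr0 n).ne'
    field_simp
  set K : ℕ → Set Plane := fun n => closure U ∩ {x | 1 ≤ |r n * φ x|} with hK
  have hKc : ∀ n, IsClosed (K n) := fun n =>
    isClosed_closure.inter (isClosed_le continuous_const (by have := hφ.continuous; fun_prop))
  -- A frontier point has `φ = 0`, so it cannot satisfy `1 ≤ |r n * φ x|`.
  have hKU : ∀ n, K n ⊆ U := by
    rintro n x ⟨hx1, hx2⟩
    by_contra hx
    have : x ∈ frontier U := by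
      rw [frontier, hU.interior_eq]; exact ⟨hx1, hx⟩
    rw [Set.mem_ofPred_eq, h0 x this] at hx2
    norm_num at hx2
  have hψ0 : ∀ n, ∀ x ∈ U, x ∉ K n → ψ n x = 0 := by
    intro n x hx hxK
    have : |r n * φ x| ≤ 1 := by
      by_contra h
      exact hxK ⟨subset_closure hx, (not_le.1 h).le⟩
    simp only [hψdef, hH1 _ this]
    have := (hr0 n).ne'
    field_simp
    ring
  have key := fun n => contDiff_indicator_of_subset hU (hKc n) (hKU n) (hψ n) (hψ0 n)
  have hcs : ∀ n, HasCompactSupport (U.indicator (ψ n)) := fun n =>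
    HasCompactSupport.of_support_subset_isCompact (hUc.inter_right
      (isClosed_le continuous_const (by have := hφ.continuous; fun_prop) :
        IsClosed {x | 1 ≤ |r n * φ x|})) ((subset_tsupport _).trans (key n).2.1)
  have hgc : ∀ n, Continuous (gradient (U.indicator (ψ n))) := fun n => continuous_gradient (key n).1
  have hgcs : ∀ n, HasCompactSupport (gradient (U.indicator (ψ n))) := fun n => by
    have : gradient (U.indicator (ψ n))
        = (InnerProductSpace.toDual ℝ Plane).symm ∘ fderiv ℝ (U.indicator (ψ n)) := rfl
    rw [this]
    exact ((hcs n).fderiv (𝕜 := ℝ)).comp_left (map_zero _)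
  have hm1 : ∀ n, MemLp (U.indicator (ψ n)) 2 (volume.restrict Ω) := fun n =>
    (key n).1.continuous.memLp_of_hasCompactSupport (hcs n)
  have hm2 : ∀ n, MemLp (gradient (U.indicator (ψ n))) 2 (volume.restrict Ω) := fun n =>
    (hgc n).memLp_of_hasCompactSupport (hgcs n)
  have hmem : ∀ n, ((hm1 n).toLp _, (hm2 n).toLp _) ∈ testPairs Ω := fun n =>
    ⟨_, (key n).1, hcs n, ((key n).2.1.trans (hKU n)).trans hUΩ, (hm1 n).coeFn_toLp,
      (hm2 n).coeFn_toLp⟩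
  -- bounding functions
  have hbd : ∀ c : ℝ, MemLp (U.indicator fun _ : Plane => c) 2 (volume.restrict Ω) := fun c =>
    memLp_indicator_const 2 hUm c (Or.inr
      ((Measure.restrict_apply_le _ _).trans_lt hb.measure_lt_top).ne)
  obtain ⟨G, hG⟩ := hUc.exists_bound_of_continuousOn (continuous_gradient hφ).continuousOn
  have hlim1 : Tendsto (fun n => (hm1 n).toLp _) atTop (𝓝 f) := by
    have hf' : MemLp (U.indicator φ) 2 (volume.restrict Ω) := (memLp_congr_ae hf).1 (Lp.memLp f)
    have : f = hf'.toLp _ := by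
      rw [← Lp.toLp_coeFn f (Lp.memLp f)]
      exact (MemLp.toLp_eq_toLp_iff _ _).2 hf
    rw [this, Lp.tendsto_Lp_iff_tendsto_eLpNorm'']
    refine tendsto_eLpNorm_two_of_dominated (hbd C) (fun n => (hm1 n).1) hf'.1 ?_ ?_
    · refine fun n => Eventually.of_forall fun x => ?_
      by_cases hx : x ∈ U
      · simp only [Set.indicator_of_mem hx, hψdef]
        have h1 : (r n)⁻¹ ≤ 1 := inv_le_one_of_one_le₀ (by simp [hr])
        have h2 := inv_pos.2 (hr0 n)
        rw [sub_sub_cancel_left, norm_neg, Real.norm_eq_abs, abs_mul, abs_of_pos h2]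
        nlinarith [(hC (r n * φ x)).1, abs_nonneg (H (r n * φ x))]
      · simp [Set.indicator_of_notMem hx]
    · refine Eventually.of_forall fun x => ?_
      by_cases hx : x ∈ U
      · simp only [Set.indicator_of_mem hx, hψdef]
        have h1 : Tendsto (fun n => (r n)⁻¹ * H (r n * φ x)) atTop (𝓝 0) := by
          refine squeeze_zero_norm (a := fun n => (r n)⁻¹ * C) (fun n => ?_) ?_
          · rw [Real.norm_eq_abs, abs_mul, abs_of_pos (inv_pos.2 (hr0 n))]
            exact mul_le_mul_of_nonneg_left (hC _).1 (inv_pos.2 (hr0 n)).le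
          · simpa using (tendsto_inv_atTop_zero.comp hrlim).mul_const C
        simpa using h1.const_sub (φ x)
      · simp only [Set.indicator_of_notMem hx]
        exact tendsto_const_nhds
  have hlim2 : Tendsto (fun n => (hm2 n).toLp _) atTop (𝓝 g) := by
    have hg' : MemLp (U.indicator (gradient φ)) 2 (volume.restrict Ω) :=
      (memLp_congr_ae hg).1 (Lp.memLp g)
    have : g = hg'.toLp _ := by
      rw [← Lp.toLp_coeFn g (Lp.memLp g)]
      exact (MemLp.toLp_eq_toLp_iff _ _).2 hg
    rw [this, Lp.tendsto_Lp_iff_tendsto_eLpNorm'']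
    refine tendsto_eLpNorm_two_of_dominated (hbd (C * G)) (fun n => (hm2 n).1) hg'.1 ?_ ?_
    · refine fun n => Eventually.of_forall fun x => ?_
      rw [(key n).2.2]
      by_cases hx : x ∈ U
      · simp only [Set.indicator_of_mem hx, hψg]
        rw [sub_smul, one_smul, sub_sub_cancel_left, norm_neg, norm_smul, Real.norm_eq_abs]
        exact mul_le_mul (hC _).2 (hG x (subset_closure hx)) (norm_nonneg _) hC0
      · simp [Set.indicator_of_notMem hx]
    · filter_upwards [ae_restrict_of_ae (ae_gradient_eq_zero_of_eq_zero hφ)] with x hxz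
      by_cases hx : x ∈ U
      · by_cases hz : φ x = 0
        · refine tendsto_const_nhds.congr fun n => ?_
          rw [(key n).2.2]
          simp only [Set.indicator_of_mem hx, hψg, hxz hz, smul_zero]
        · have hev : ∀ᶠ n in atTop, 2 < |r n * φ x| := by
            have : Tendsto (fun n => r n * |φ x|) atTop atTop :=
              hrlim.atTop_mul_const (abs_pos.2 hz)
            filter_upwards [this.eventually_gt_atTop 2] with n hn
            rwa [abs_mul, abs_of_pos (hr0 n)]
          refine tendsto_const_nhds.congr' ?_
          filter_upwards [hev] with n hn
          rw [(key n).2.2]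
          simp only [Set.indicator_of_mem hx, hψg, (hH2 _ hn).2, sub_zero, one_smul]
      · refine tendsto_const_nhds.congr fun n => ?_
        rw [(key n).2.2]
        simp only [Set.indicator_of_notMem hx]
  exact mem_closure_of_tendsto (hlim1.prodMk_nhds hlim2) (Eventually.of_forall hmem)

/-! ### Systems of eigenfunctions -/

/-- A complete orthonormal system of smooth Dirichlet eigenfunctions of a bounded open set. -/
structure IsEigenSystem {ι : Type*} [DecidableEq ι] (U : Set Plane) (ev : ι → ℝ)
    (φ : ι → Plane → ℝ) : Prop where
  isOpen : IsOpen U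
  isBounded : Bornology.IsBounded U
  contDiff : ∀ i, ContDiff ℝ ∞ (φ i)
  frontier_eq_zero : ∀ i, ∀ x ∈ frontier U, φ i x = 0
  weak : ∀ i, ∀ ψ : Plane → ℝ, ContDiff ℝ ∞ ψ → HasCompactSupport ψ → tsupport ψ ⊆ U →
    ∫ x, inner ℝ (gradient (φ i) x) (gradient ψ x) = ev i * ∫ x, φ i x * ψ x
  ortho : ∀ i j, ∫ x in U, φ i x * φ j x = if i = j then 1 else 0
  complete : ∀ f : Plane → ℝ, IntegrableOn f U → (∀ i, ∫ x in U, f x * φ i x = 0) →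
    f =ᵐ[volume.restrict U] 0

/-! ### Transport of eigensystems by isometries of the plane. -/

theorem AffineIsometryEquiv.measurePreserving_plane (e : Plane ≃ᵃⁱ[ℝ] Plane) :
    MeasurePreserving e := by
  have h : (e : Plane → Plane) = (fun x => x + e 0) ∘ e.linearIsometryEquiv := by
    funext x
    have := e.map_vadd 0 x
    simpa using this
  rw [h]
  exact (measurePreserving_add_right volume (e 0)).comp e.linearIsometryEquiv.measurePreserving

theorem AffineIsometryEquiv.measurableEmbedding_plane (e : Plane ≃ᵃⁱ[ℝ] Plane) :
    MeasurableEmbedding e :=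
  e.toHomeomorph.measurableEmbedding

theorem AffineIsometryEquiv.hasFDerivAt_plane (e : Plane ≃ᵃⁱ[ℝ] Plane) (x : Plane) :
    HasFDerivAt e (e.linearIsometryEquiv.toContinuousLinearEquiv : Plane →L[ℝ] Plane) x := by
  have h : (e : Plane → Plane) = fun x => e.linearIsometryEquiv x + e 0 := by
    funext x
    have := e.map_vadd 0 x
    simpa using this
  rw [h]
  exact (e.linearIsometryEquiv.toContinuousLinearEquiv.hasFDerivAt (x := x)).add_const _

theorem AffineIsometryEquiv.contDiff_plane (e : Plane ≃ᵃⁱ[ℝ] Plane) : ContDiff ℝ ∞ e := by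
  have h : (e : Plane → Plane) = fun x => e.linearIsometryEquiv x + e 0 := by
    funext x
    have := e.map_vadd 0 x
    simpa using this
  rw [h]
  exact (e.linearIsometryEquiv.contDiff).add contDiff_const

theorem gradient_comp_affineIsometryEquiv (e : Plane ≃ᵃⁱ[ℝ] Plane) {φ : Plane → ℝ}
    (hφ : ContDiff ℝ ∞ φ) (x : Plane) :
    gradient (φ ∘ e) x = e.linearIsometryEquiv.symm (gradient φ (e x)) := by
  have d1 := ((hφ.differentiable (by simp) (e x)).hasGradientAt).hasFDerivAt
  have d2 := d1.comp x (e.hasFDerivAt_plane x)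
  refine HasGradientAt.gradient ?_
  rw [hasGradientAt_iff_hasFDerivAt]
  refine d2.congr_fderiv ?_
  ext v
  simp only [ContinuousLinearMap.comp_apply, InnerProductSpace.toDual_apply_apply]
  rw [← e.linearIsometryEquiv.inner_map_map (e.linearIsometryEquiv.symm _),
    LinearIsometryEquiv.apply_symm_apply]
  rfl

namespace IsEigenSystem

variable {ι : Type*} [DecidableEq ι] {U : Set Plane} {ev : ι → ℝ} {φ : ι → Plane → ℝ}

theorem congr_ev (h : IsEigenSystem U ev φ) {ev' : ι → ℝ} (he : ∀ i, ev i = ev' i) :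
    IsEigenSystem U ev' φ := by
  have : ev = ev' := funext he
  rwa [← this]

theorem image (h : IsEigenSystem U ev φ) (e : Plane ≃ᵃⁱ[ℝ] Plane) :
    IsEigenSystem (e '' U) ev (fun i => φ i ∘ e.symm) where
  isOpen := e.toHomeomorph.isOpenMap _ h.isOpen
  isBounded := e.isometry.lipschitz.isBounded_image h.isBounded
  contDiff i := (h.contDiff i).comp e.symm.contDiff_plane
  frontier_eq_zero i x hx := by
    have hf : frontier (e '' U) = e '' frontier U := (e.toHomeomorph.image_frontier U).symm
    rw [hf] at hx
    obtain ⟨y, hy, rfl⟩ := hx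
    simpa using h.frontier_eq_zero i y hy
  weak i ψ hψ hc hs := by
    have hts : tsupport (ψ ∘ e) = e ⁻¹' tsupport ψ := tsupport_comp_eq_preimage ψ e.toHomeomorph
    have := h.weak i (ψ ∘ e) (hψ.comp e.contDiff_plane)
      (hc.comp_homeomorph e.toHomeomorph) (by
        rw [hts]
        intro x hx
        obtain ⟨y, hy, hxy⟩ := hs hx
        rwa [← e.injective hxy])
    rw [← e.measurePreserving_plane.integral_comp e.measurableEmbedding_plane
        fun x => inner ℝ (gradient (φ i ∘ e.symm) x) (gradient ψ x),
      ← e.measurePreserving_plane.integral_comp e.measurableEmbedding_plane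
        fun x => (φ i ∘ e.symm) x * ψ x]
    rw [show (fun x => inner ℝ (gradient (φ i ∘ e.symm) (e x)) (gradient ψ (e x)))
      = fun x => inner ℝ (gradient (φ i) x) (gradient (ψ ∘ e) x) from ?_]
    · simpa using this
    · funext x
      rw [gradient_comp_affineIsometryEquiv e.symm (h.contDiff i),
        gradient_comp_affineIsometryEquiv e hψ, AffineIsometryEquiv.symm_apply_apply]
      rw [← e.linearIsometryEquiv.inner_map_map (gradient (φ i) x),
        LinearIsometryEquiv.apply_symm_apply]
      rfl
  ortho i j := by
    rw [e.measurePreserving_plane.setIntegral_image_emb e.measurableEmbedding_plane]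
    simpa using h.ortho i j
  complete f hf h0 := by
    have h1 := h.complete (f ∘ e)
      ((e.measurePreserving_plane.integrableOn_image e.measurableEmbedding_plane).1 hf) fun i => by
        have := h0 i
        rw [e.measurePreserving_plane.setIntegral_image_emb e.measurableEmbedding_plane] at this
        simpa using this
    have hmp := e.measurePreserving_plane.restrict_image_emb e.measurableEmbedding_plane U
    rw [← hmp.map_eq]
    exact (e.measurableEmbedding_plane.ae_map_iff).2 h1

/-! ### Eigenfunctions of a component, extended by zero. -/

theorem memLp (h : IsEigenSystem U ev φ) (i : ι) (Ω : Set Plane) :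
    MemLp (U.indicator (φ i)) 2 (volume.restrict Ω) := by
  obtain ⟨C, hC⟩ := h.isBounded.isCompact_closure.exists_bound_of_continuousOn
    (h.contDiff i).continuous.continuousOn
  refine MemLp.of_le (g := U.indicator fun _ => C) (memLp_indicator_const 2 h.isOpen.measurableSet C
    (Or.inr ((Measure.restrict_apply_le _ _).trans_lt h.isBounded.measure_lt_top).ne))
    (((h.contDiff i).continuous.aestronglyMeasurable).indicator h.isOpen.measurableSet)
    (Eventually.of_forall fun x => ?_)
  by_cases hx : x ∈ U
  · simp only [Set.indicator_of_mem hx]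
    exact (hC x (subset_closure hx)).trans (le_abs_self C)
  · simp [Set.indicator_of_notMem hx]

theorem memLp_gradient (h : IsEigenSystem U ev φ) (i : ι) (Ω : Set Plane) :
    MemLp (U.indicator (gradient (φ i))) 2 (volume.restrict Ω) := by
  have hc := continuous_gradient (h.contDiff i)
  obtain ⟨C, hC⟩ := h.isBounded.isCompact_closure.exists_bound_of_continuousOn hc.continuousOn
  refine MemLp.of_le (g := U.indicator fun _ => C) (memLp_indicator_const 2 h.isOpen.measurableSet C
    (Or.inr ((Measure.restrict_apply_le _ _).trans_lt h.isBounded.measure_lt_top).ne))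
    (hc.aestronglyMeasurable.indicator h.isOpen.measurableSet)
    (Eventually.of_forall fun x => ?_)
  by_cases hx : x ∈ U
  · simp only [Set.indicator_of_mem hx]
    exact (hC x (subset_closure hx)).trans (le_abs_self C)
  · simp [Set.indicator_of_notMem hx]

theorem setIntegral_indicator_mul {Ω : Set Plane} (hU : MeasurableSet U) (hUΩ : U ⊆ Ω)
    (f g : Plane → ℝ) : ∫ x in Ω, U.indicator f x * g x = ∫ x in U, f x * g x := by
  have : (fun x => U.indicator f x * g x) = U.indicator fun x => f x * g x := by
    funext x
    by_cases hx : x ∈ U <;> simp [hx]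
  rw [this, setIntegral_indicator hU, Set.inter_eq_self_of_subset_right hUΩ]

/-- A test function on `Ω`, cut off to the component `U`, is a test function on `U`, so the weak
equation on `U` is all that is used. -/
theorem hasDirichletLaplacian (h : IsEigenSystem U ev φ) {Ω : Set Plane} (hUΩ : U ⊆ Ω)
    (hdiff : IsOpen (Ω \ U)) (i : ι) {f : L2Fun Ω}
    (hf : f =ᵐ[volume.restrict Ω] U.indicator (φ i)) :
    HasDirichletLaplacian Ω f (-(ev i • f)) := by
  have hUm := h.isOpen.measurableSet
  set g : L2Field Ω := (h.memLp_gradient i Ω).toLp _ with hg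
  have hg' : g =ᵐ[volume.restrict Ω] U.indicator (gradient (φ i)) := MemLp.coeFn_toLp _
  refine hasDirichletLaplacian_of_testPairs (mem_sobolevH10_of_contDiff h.isOpen h.isBounded hUΩ
    (h.contDiff i) (h.frontier_eq_zero i) hf hg') ?_
  rintro v ⟨ψ, hψ, hψc, hψs, hv1, hv2⟩
  -- Since `Ω \ U` is open, this part of the support, which is the part inside `U`, is closed. No
  -- cut-off is needed near the frontier of `U`.
  have hK : IsClosed (tsupport ψ ∩ (Ω \ U)ᶜ) := (isClosed_tsupport ψ).inter hdiff.isClosed_compl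
  have hKU : tsupport ψ ∩ (Ω \ U)ᶜ ⊆ U := by
    rintro x ⟨hx1, hx2⟩
    by_contra hx
    exact hx2 ⟨hψs hx1, hx⟩
  obtain ⟨k1, k2, k3⟩ := contDiff_indicator_of_subset h.isOpen hK hKU hψ fun x hx hxK => by
    by_contra hne
    exact hxK ⟨subset_tsupport ψ hne, fun h' => h'.2 hx⟩
  have hcs : HasCompactSupport (U.indicator ψ) :=
    HasCompactSupport.of_support_subset_isCompact (hψc.isCompact.inter_right hdiff.isClosed_compl)
      ((subset_tsupport _).trans k2)
  have hw := h.weak i _ k1 hcs (k2.trans hKU)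
  have e1 : (inner ℝ g v.2 : ℝ)
      = ∫ x, inner ℝ (gradient (φ i) x) (gradient (U.indicator ψ) x) := by
    rw [L2.inner_def, k3]
    have a1 : ∫ x in Ω, inner ℝ (g x) (v.2 x)
        = ∫ x in Ω, U.indicator (fun x => inner ℝ (gradient (φ i) x) (gradient ψ x)) x := by
      refine integral_congr_ae ?_
      filter_upwards [hg', hv2] with x h1 h2
      rw [h1, h2]
      by_cases hx : x ∈ U <;> simp [hx]
    have a2 : (fun x => (inner ℝ (gradient (φ i) x) (U.indicator (gradient ψ) x) : ℝ))
        = U.indicator (fun x => inner ℝ (gradient (φ i) x) (gradient ψ x)) := by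
      funext x
      by_cases hx : x ∈ U <;> simp [hx]
    rw [a1, a2, setIntegral_indicator hUm, Set.inter_eq_self_of_subset_right hUΩ,
      integral_indicator hUm]
  have e2 : (inner ℝ f v.1 : ℝ) = ∫ x, φ i x * U.indicator ψ x := by
    rw [L2.inner_def]
    have a1 : ∫ x in Ω, inner ℝ (f x) (v.1 x)
        = ∫ x in Ω, U.indicator (fun x => φ i x * ψ x) x := by
      refine integral_congr_ae ?_
      filter_upwards [hf, hv1] with x h1 h2
      rw [h1, h2]
      by_cases hx : x ∈ U <;> simp [hx, mul_comm]
    have a2 : (fun x => φ i x * U.indicator ψ x)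
        = U.indicator (fun x => φ i x * ψ x) := by
      funext x
      by_cases hx : x ∈ U <;> simp [hx]
    rw [a1, a2, setIntegral_indicator hUm, Set.inter_eq_self_of_subset_right hUΩ,
      integral_indicator hUm]
  rw [e1, hw, inner_neg_left, inner_smul_left, e2]
  simp

end IsEigenSystem

/-- The eigenfunctions of the components of a disjoint union of bounded open sets form an
orthonormal basis of eigenfunctions of the union. -/
theorem exists_hilbertBasis_iUnion {ι κ : Type*} [DecidableEq ι] [Countable κ]
    {U : κ → Set Plane} {ev : κ → ι → ℝ} {φ : κ → ι → Plane → ℝ}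
    (h : ∀ k, IsEigenSystem (U k) (ev k) (φ k)) (hd : Pairwise fun k l => Disjoint (U k) (U l)) :
    ∃ b : HilbertBasis (κ × ι) ℝ (L2Fun (⋃ k, U k)),
      (∀ p, b p =ᵐ[volume.restrict (⋃ k, U k)] (U p.1).indicator (φ p.1 p.2)) ∧
      ∀ p, HasDirichletLaplacian (⋃ k, U k) (b p) (-(ev p.1 p.2 • b p)) := by
  classical
  set Ω := ⋃ k, U k with hΩ
  have hUΩ : ∀ k, U k ⊆ Ω := fun k => Set.subset_iUnion U k
  have hUm := fun k => (h k).isOpen.measurableSet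
  -- The rest of `Ω` is the union of the other components.
  have hdiff : ∀ k, IsOpen (Ω \ U k) := by
    intro k
    have : Ω \ U k = ⋃ l ∈ {l | l ≠ k}, U l := by
      ext x
      simp only [hΩ, Set.mem_sdiff, Set.mem_iUnion, Set.mem_ofPred_eq, exists_prop]
      constructor
      · rintro ⟨⟨l, hl⟩, hk⟩
        exact ⟨l, fun e => hk (e ▸ hl), hl⟩
      · rintro ⟨l, hlk, hl⟩
        exact ⟨⟨l, hl⟩, fun hk => Set.disjoint_left.1 (hd hlk) hl hk⟩
    rw [this]
    exact isOpen_biUnion fun l _ => (h l).isOpen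
  set v : κ × ι → L2Fun Ω := fun p => ((h p.1).memLp p.2 Ω).toLp _ with hv
  have hv' : ∀ p, v p =ᵐ[volume.restrict Ω] (U p.1).indicator (φ p.1 p.2) :=
    fun p => MemLp.coeFn_toLp _
  have hinner : ∀ (f : L2Fun Ω) p, (inner ℝ (v p) f : ℝ) = ∫ x in U p.1, φ p.1 p.2 x * f x := by
    intro f p
    rw [L2.inner_def, ← IsEigenSystem.setIntegral_indicator_mul (hUm p.1) (hUΩ p.1)]
    refine integral_congr_ae ?_
    filter_upwards [hv' p] with x hx
    rw [hx]
    simp [mul_comm]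
  have hon : Orthonormal ℝ v := by
    rw [orthonormal_iff_ite]
    rintro ⟨k, i⟩ ⟨l, j⟩
    rw [hinner]
    have hae : ∀ᵐ x ∂volume.restrict (U k), v (l, j) x = (U l).indicator (φ l j) x :=
      ae_restrict_of_ae_restrict_of_subset (hUΩ k) (hv' (l, j))
    have e : ∫ x in U k, φ k i x * v (l, j) x
        = ∫ x in U k, φ k i x * (U l).indicator (φ l j) x := by
      refine integral_congr_ae ?_
      filter_upwards [hae] with x hx
      rw [hx]
    rw [e]
    by_cases hkl : k = l
    · subst hkl
      have := (h k).ortho i j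
      simp only [Prod.mk.injEq, true_and]
      rw [← this]
      refine setIntegral_congr_fun (hUm k) fun x hx => ?_
      simp [Set.indicator_of_mem hx]
    · rw [if_neg (by simp [hkl])]
      refine (setIntegral_congr_fun (hUm k) (g := fun _ => (0 : ℝ)) fun x hx => ?_).trans (by simp)
      simp [Set.indicator_of_notMem (Set.disjoint_left.1 (hd hkl) hx)]
  -- A vector orthogonal to the system vanishes almost everywhere on each component, by completeness
  -- there, and there are only countably many components.
  have hbot : (Submodule.span ℝ (Set.range v))ᗮ = ⊥ := by
    rw [Submodule.eq_bot_iff]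
    intro f hf
    have hf0 : ∀ p, (inner ℝ (v p) f : ℝ) = 0 := fun p =>
      (Submodule.mem_orthogonal _ _).1 hf _ (Submodule.subset_span ⟨p, rfl⟩)
    have hz : ∀ k, ∀ᵐ x ∂volume.restrict (U k), f x = 0 := by
      intro k
      have : IsFiniteMeasure ((volume : Measure Plane).restrict (U k)) :=
        ⟨by rw [Measure.restrict_apply_univ]; exact (h k).isBounded.measure_lt_top⟩
      have hm : MemLp f 2 (volume.restrict (U k)) :=
        (Lp.memLp f).mono_measure (Measure.restrict_mono (hUΩ k) le_rfl)
      refine (h k).complete f (hm.integrable (by norm_num)) fun i => ?_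
      have := hf0 (k, i)
      rw [hinner] at this
      simpa [mul_comm] using this
    have := (ae_restrict_iUnion_iff U fun x => f x = 0).2 hz
    exact (Lp.eq_zero_iff_ae_eq_zero).2 this
  refine ⟨HilbertBasis.mkOfOrthogonalEqBot hon hbot, fun p => ?_, fun p => ?_⟩
  · rw [HilbertBasis.coe_mkOfOrthogonalEqBot]; exact hv' p
  · rw [HilbertBasis.coe_mkOfOrthogonalEqBot]
    exact (h p.1).hasDirichletLaplacian (hUΩ p.1) (hdiff p.1) p.2 (hv' p)

/-! ### Coordinates of the plane -/

/-- The plane as a product of two lines. -/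
noncomputable def planeEquiv : Plane ≃ᵐ ℝ × ℝ :=
  (MeasurableEquiv.toLp 2 (Fin 2 → ℝ)).symm.trans MeasurableEquiv.finTwoArrow

theorem planeEquiv_apply (x : Plane) : planeEquiv x = (x 0, x 1) := rfl

theorem measurePreserving_planeEquiv : MeasurePreserving planeEquiv :=
  (EuclideanSpace.volume_preserving_symm_measurableEquiv_toLp (Fin 2)).trans
    (volume_preserving_finTwoArrow ℝ)

/-- The open rectangle `(0, a) × (0, b)`. -/
def openRect (a b : ℝ) : Set Plane := {x : Plane | 0 < x 0 ∧ x 0 < a ∧ 0 < x 1 ∧ x 1 < b}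

theorem openRect_eq_preimage (a b : ℝ) :
    openRect a b = planeEquiv ⁻¹' (Set.Ioo 0 a ×ˢ Set.Ioo 0 b) := by
  ext x
  simp only [openRect, Set.mem_ofPred_eq, Set.mem_preimage, planeEquiv_apply, Set.mem_prod,
    Set.mem_Ioo]
  tauto

theorem continuous_coord (k : Fin 2) : Continuous fun x : Plane => x k := by fun_prop

theorem isOpen_openRect (a b : ℝ) : IsOpen (openRect a b) :=
  (isOpen_lt continuous_const (continuous_coord 0)).inter
    ((isOpen_lt (continuous_coord 0) continuous_const).inter
      ((isOpen_lt continuous_const (continuous_coord 1)).inter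
        (isOpen_lt (continuous_coord 1) continuous_const)))

/-- The closed rectangle `[0, a] × [0, b]`. -/
def closedRect (a b : ℝ) : Set Plane := {x : Plane | 0 ≤ x 0 ∧ x 0 ≤ a ∧ 0 ≤ x 1 ∧ x 1 ≤ b}

theorem isClosed_closedRect (a b : ℝ) : IsClosed (closedRect a b) :=
  (isClosed_le continuous_const (continuous_coord 0)).inter
    ((isClosed_le (continuous_coord 0) continuous_const).inter
      ((isClosed_le continuous_const (continuous_coord 1)).inter
        (isClosed_le (continuous_coord 1) continuous_const)))

theorem isCompact_closedRect (a b : ℝ) : IsCompact (closedRect a b) := by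
  refine Metric.isCompact_of_isClosed_isBounded (isClosed_closedRect a b) ?_
  refine Metric.isBounded_iff_subset_closedBall 0 |>.2 ⟨|a| + |b|, ?_⟩
  rintro x ⟨h1, h2, h3, h4⟩
  rw [mem_closedBall_zero_iff, EuclideanSpace.norm_eq, Fin.sum_univ_two]
  have ha := le_abs_self a
  have hb := le_abs_self b
  rw [Real.sqrt_le_left (by positivity)]
  simp only [Real.norm_eq_abs, sq_abs]
  nlinarith [abs_nonneg a, abs_nonneg b, mul_nonneg (abs_nonneg a) (abs_nonneg b)]

theorem openRect_subset_closedRect (a b : ℝ) : openRect a b ⊆ closedRect a b :=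
  fun _ ⟨h1, h2, h3, h4⟩ => ⟨h1.le, h2.le, h3.le, h4.le⟩

theorem setIntegral_openRect_mul (a b : ℝ) (f g : ℝ → ℝ) :
    ∫ x in openRect a b, f (x 0) * g (x 1)
      = (∫ s in Set.Ioo 0 a, f s) * ∫ s in Set.Ioo 0 b, g s := by
  rw [openRect_eq_preimage]
  have := measurePreserving_planeEquiv.setIntegral_preimage_emb planeEquiv.measurableEmbedding
    (fun p : ℝ × ℝ => f p.1 * g p.2) (Set.Ioo 0 a ×ˢ Set.Ioo 0 b)
  simp only [planeEquiv_apply] at this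
  rw [this, Measure.volume_eq_prod, setIntegral_prod_mul]

theorem volume_openRect (a b : ℝ) :
    volume (openRect a b) = ENNReal.ofReal a * ENNReal.ofReal b := by
  rw [openRect_eq_preimage, measurePreserving_planeEquiv.measure_preimage_equiv,
    Measure.volume_eq_prod, Measure.prod_prod, Real.volume_Ioo, Real.volume_Ioo, sub_zero, sub_zero]

theorem integral_cos_int_mul {a : ℝ} (ha : 0 < a) (k : ℤ) :
    ∫ s in Set.Ioo 0 a, Real.cos (k * Real.pi / a * s) = if k = 0 then a else 0 := by
  rw [← integral_Ioc_eq_integral_Ioo, ← intervalIntegral.integral_of_le ha.le]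
  split_ifs with hk
  · subst hk; simp
  · have hk' : (k : ℝ) ≠ 0 := by exact_mod_cast hk
    have hc : (k : ℝ) * Real.pi / a ≠ 0 := by have := Real.pi_ne_zero; positivity
    rw [intervalIntegral.integral_comp_mul_left Real.cos hc, integral_cos]
    have : (k : ℝ) * Real.pi / a * a = k * Real.pi := by field_simp
    rw [this]
    simp [Real.sin_int_mul_pi]

theorem integral_sin_mul_sin {a : ℝ} (ha : 0 < a) {m n : ℕ} (hm : 0 < m) :
    ∫ s in Set.Ioo 0 a, Real.sin (m * Real.pi / a * s) * Real.sin (n * Real.pi / a * s)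
      = if m = n then a / 2 else 0 := by
  have e : ∀ s : ℝ, Real.sin (m * Real.pi / a * s) * Real.sin (n * Real.pi / a * s)
      = (Real.cos (((m - n : ℤ) : ℝ) * Real.pi / a * s)
        - Real.cos (((m + n : ℤ) : ℝ) * Real.pi / a * s)) / 2 := by
    intro s
    have h1 : ((m - n : ℤ) : ℝ) * Real.pi / a * s
        = m * Real.pi / a * s - n * Real.pi / a * s := by push_cast; ring
    have h2 : ((m + n : ℤ) : ℝ) * Real.pi / a * s
        = m * Real.pi / a * s + n * Real.pi / a * s := by push_cast; ring
    rw [h1, h2, Real.cos_sub, Real.cos_add]; ring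
  have hi : ∀ k : ℤ, IntegrableOn (fun s : ℝ => Real.cos (k * Real.pi / a * s)) (Set.Ioo 0 a) :=
    fun k => (Continuous.integrableOn_Icc (by fun_prop)).mono_set Set.Ioo_subset_Icc_self
  simp_rw [e]
  rw [integral_div, integral_sub (hi _) (hi _), integral_cos_int_mul ha, integral_cos_int_mul ha,
    if_neg (show ¬((m : ℤ) + n = 0) by omega)]
  by_cases h : m = n
  · rw [if_pos (by omega), if_pos h]; ring
  · rw [if_neg (by omega), if_neg h]; ring

/-! ### The Laplace equation for trigonometric products -/

theorem fderiv_apply_of_hasDerivAt {φ : Plane → ℝ} (hφ : ContDiff ℝ ∞ φ) {x v : Plane} {d : ℝ}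
    (h : HasDerivAt (fun t : ℝ => φ (x + t • v)) d 0) : fderiv ℝ φ x v = d := by
  rw [← (hφ.differentiable (by simp) x).lineDeriv_eq_fderiv]
  exact h.deriv

theorem gradient_coord {φ : Plane → ℝ} (hφ : ContDiff ℝ ∞ φ) (x : Plane) (k : Fin 2) :
    gradient φ x k = fderiv ℝ φ x (EuclideanSpace.single k 1) := by
  rw [((hφ.differentiable (by simp) x).hasGradientAt).fderiv_apply]
  rw [EuclideanSpace.inner_single_right]
  simp

/-- Integration by parts in each coordinate over the whole plane, where `φ` solves the equation;
compact support of `ψ` leaves no boundary term. -/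
theorem integral_inner_gradient_eq {φ : Plane → ℝ} {ev : ℝ} (hφ : ContDiff ℝ ∞ φ)
    (hL : ∀ x, ∑ k : Fin 2, fderiv ℝ (fun y => fderiv ℝ φ y (EuclideanSpace.single k 1)) x
      (EuclideanSpace.single k 1) = -(ev * φ x))
    {ψ : Plane → ℝ} (hψ : ContDiff ℝ ∞ ψ) (hψc : HasCompactSupport ψ) :
    ∫ x, inner ℝ (gradient φ x) (gradient ψ x) = ev * ∫ x, φ x * ψ x := by
  set e : Fin 2 → Plane := fun k => EuclideanSpace.single k 1 with he
  have hd : ∀ k, ContDiff ℝ ∞ fun y => fderiv ℝ φ y (e k) := fun k =>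
    (hφ.fderiv_right (m := ∞) (by simp)).clm_apply contDiff_const
  have hdψ : ∀ k, ContDiff ℝ ∞ fun y => fderiv ℝ ψ y (e k) := fun k =>
    (hψ.fderiv_right (m := ∞) (by simp)).clm_apply contDiff_const
  have hdd : ∀ k, ContDiff ℝ ∞ fun y => fderiv ℝ (fun z => fderiv ℝ φ z (e k)) y (e k) := fun k =>
    ((hd k).fderiv_right (m := ∞) (by simp)).clm_apply contDiff_const
  have hcψ : ∀ k, HasCompactSupport fun y => fderiv ℝ ψ y (e k) := fun k =>
    hψc.fderiv_apply (𝕜 := ℝ) (e k)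
  have i1 : ∀ k, Integrable fun x => fderiv ℝ φ x (e k) * fderiv ℝ ψ x (e k) := fun k =>
    ((hd k).continuous.mul (hdψ k).continuous).integrable_of_hasCompactSupport (hcψ k).mul_left
  have i2 : ∀ k, Integrable fun x => fderiv ℝ (fun z => fderiv ℝ φ z (e k)) x (e k) * ψ x :=
    fun k => ((hdd k).continuous.mul hψ.continuous).integrable_of_hasCompactSupport hψc.mul_left
  have i3 : ∀ k, Integrable fun x => fderiv ℝ φ x (e k) * ψ x :=
    fun k => ((hd k).continuous.mul hψ.continuous).integrable_of_hasCompactSupport hψc.mul_left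
  have h1 : ∀ x, (inner ℝ (gradient φ x) (gradient ψ x) : ℝ)
      = ∑ k : Fin 2, fderiv ℝ φ x (e k) * fderiv ℝ ψ x (e k) := by
    intro x
    rw [PiLp.inner_apply]
    refine Finset.sum_congr rfl fun k _ => ?_
    rw [gradient_coord hφ, gradient_coord hψ]
    simp [he, mul_comm]
  have h2 : ∀ k, ∫ x, fderiv ℝ φ x (e k) * fderiv ℝ ψ x (e k)
      = -∫ x, fderiv ℝ (fun z => fderiv ℝ φ z (e k)) x (e k) * ψ x := fun k =>
    integral_mul_fderiv_eq_neg_fderiv_mul_of_integrable (i2 k) (i1 k) (i3 k)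
      (fun x _ => (hd k).differentiable (by simp) x) (fun x _ => hψ.differentiable (by simp) x)
  simp_rw [h1]
  rw [integral_finsetSum _ fun k _ => i1 k]
  simp_rw [h2]
  rw [Finset.sum_neg_distrib, ← integral_finsetSum _ fun k _ => i2 k, ← integral_neg,
    ← integral_const_mul]
  refine integral_congr_ae (Eventually.of_forall fun x => ?_)
  simp only
  rw [← Finset.sum_mul, hL x]
  ring

/-- The product `sin (α x₀) sin (β x₁)`. -/
noncomputable def sinProd (α β : ℝ) (x : Plane) : ℝ := Real.sin (α * x 0) * Real.sin (β * x 1)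

theorem contDiff_sinProd (α β : ℝ) : ContDiff ℝ ∞ (sinProd α β) := by
  unfold sinProd
  fun_prop

/-- The combination `c (sin (α x₀) sin (β x₁) - d sin (β x₀) sin (α x₁))`. -/
noncomputable def trigFun (c d α β : ℝ) (x : Plane) : ℝ :=
  c * (sinProd α β x - d * sinProd β α x)

theorem contDiff_trigFun (c d α β : ℝ) : ContDiff ℝ ∞ (trigFun c d α β) := by
  unfold trigFun sinProd
  fun_prop

/-- One computation serves both shapes: `d = 0` gives the eigenfunctions of rectangles, `d = 1`
those of the triangle. -/
theorem trigFun_laplacian (c d α β : ℝ) (x : Plane) :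
    ∑ k : Fin 2, fderiv ℝ (fun y => fderiv ℝ (trigFun c d α β) y (EuclideanSpace.single k 1)) x
      (EuclideanSpace.single k 1) = -((α ^ 2 + β ^ 2) * trigFun c d α β x) := by
  have hs : ∀ γ r : ℝ, HasDerivAt (fun t : ℝ => Real.sin (γ * (r + t))) (γ * Real.cos (γ * r)) 0 := by
    intro γ r
    have h := ((hasDerivAt_id (0 : ℝ)).const_add r).const_mul γ
    have := h.sin
    simpa [mul_comm] using this
  have hc : ∀ γ r : ℝ,
      HasDerivAt (fun t : ℝ => Real.cos (γ * (r + t))) (-(γ * Real.sin (γ * r))) 0 := by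
    intro γ r
    have h := ((hasDerivAt_id (0 : ℝ)).const_add r).const_mul γ
    have := h.cos
    simpa [mul_comm] using this
  have hd0 : (fun y => fderiv ℝ (trigFun c d α β) y (EuclideanSpace.single 0 1)) = fun y : Plane =>
      c * (α * Real.cos (α * y 0) * Real.sin (β * y 1)
        - d * (β * Real.cos (β * y 0) * Real.sin (α * y 1))) := by
    funext y
    refine fderiv_apply_of_hasDerivAt (contDiff_trigFun _ _ _ _) ?_
    have := (((hs α (y 0)).mul_const (Real.sin (β * y 1))).sub
      (((hs β (y 0)).mul_const (Real.sin (α * y 1))).const_mul d)).const_mul c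
    simpa [trigFun, sinProd] using this
  have hd1 : (fun y => fderiv ℝ (trigFun c d α β) y (EuclideanSpace.single 1 1)) = fun y : Plane =>
      c * (Real.sin (α * y 0) * (β * Real.cos (β * y 1))
        - d * (Real.sin (β * y 0) * (α * Real.cos (α * y 1)))) := by
    funext y
    refine fderiv_apply_of_hasDerivAt (contDiff_trigFun _ _ _ _) ?_
    have := (((hs β (y 1)).const_mul (Real.sin (α * y 0))).sub
      (((hs α (y 1)).const_mul (Real.sin (β * y 0))).const_mul d)).const_mul c
    simpa [trigFun, sinProd] using this
  rw [Fin.sum_univ_two, hd0, hd1]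
  have hdd0 := fderiv_apply_of_hasDerivAt (φ := fun y : Plane =>
      c * (α * Real.cos (α * y 0) * Real.sin (β * y 1)
        - d * (β * Real.cos (β * y 0) * Real.sin (α * y 1)))) (by fun_prop) (x := x)
      (v := EuclideanSpace.single 0 1)
      (d := c * (α * -(α * Real.sin (α * x 0)) * Real.sin (β * x 1)
        - d * (β * -(β * Real.sin (β * x 0)) * Real.sin (α * x 1)))) (by
    have := ((((hc α (x 0)).const_mul α).mul_const (Real.sin (β * x 1))).sub
      ((((hc β (x 0)).const_mul β).mul_const (Real.sin (α * x 1))).const_mul d)).const_mul c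
    simpa using this)
  have hdd1 := fderiv_apply_of_hasDerivAt (φ := fun y : Plane =>
      c * (Real.sin (α * y 0) * (β * Real.cos (β * y 1))
        - d * (Real.sin (β * y 0) * (α * Real.cos (α * y 1))))) (by fun_prop) (x := x)
      (v := EuclideanSpace.single 1 1)
      (d := c * (Real.sin (α * x 0) * (β * -(β * Real.sin (β * x 1)))
        - d * (Real.sin (β * x 0) * (α * -(α * Real.sin (α * x 1)))))) (by
    have := ((((hc β (x 1)).const_mul β).const_mul (Real.sin (α * x 0))).sub
      ((((hc α (x 1)).const_mul α).const_mul (Real.sin (β * x 0))).const_mul d)).const_mul c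
    simpa using this)
  rw [hdd0, hdd1]
  simp only [trigFun, sinProd]
  ring

/-! ### Completeness of the sine products on a rectangle -/

theorem integrableOn_openRect_mul {a b : ℝ} {f g : Plane → ℝ} (hf : IntegrableOn f (openRect a b))
    (hg : Continuous g) : IntegrableOn (fun x => f x * g x) (openRect a b) :=
  hf.mul_continuousOn_of_subset hg.continuousOn (isOpen_openRect a b).measurableSet
    (isCompact_closedRect a b) (openRect_subset_closedRect a b)

theorem continuous_sinProd (α β : ℝ) : Continuous (sinProd α β) := (contDiff_sinProd α β).continuous

/-- The function `cos (γ x_k)` on the plane. -/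
noncomputable def cosCoord (γ : ℝ) (k : Fin 2) : C(Plane, ℝ) :=
  ⟨fun x => Real.cos (γ * x k), by fun_prop⟩

/-- Since `2 sin (mθ) cos θ = sin ((m+1)θ) + sin ((m-1)θ)`, multiplication by a cosine only shifts
indices, so orthogonality to all sine products survives it. Integer indices are used because `m - 1`
may leave the positive range. -/
theorem integral_sinProd_mul_adjoin {a b : ℝ} {f : Plane → ℝ} (hf : IntegrableOn f (openRect a b))
    (h : ∀ m n : ℤ, ∫ x in openRect a b,
      f x * sinProd (m * Real.pi / a) (n * Real.pi / b) x = 0)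
    {g : C(Plane, ℝ)}
    (hg : g ∈ Algebra.adjoin ℝ {cosCoord (Real.pi / a) 0, cosCoord (Real.pi / b) 1}) (m n : ℤ) :
    ∫ x in openRect a b, f x * sinProd (m * Real.pi / a) (n * Real.pi / b) x * g x = 0 := by
  set P : C(Plane, ℝ) → Prop := fun g => ∀ m n : ℤ, ∫ x in openRect a b,
    f x * sinProd (m * Real.pi / a) (n * Real.pi / b) x * g x = 0 with hP
  have hint : ∀ (m n : ℤ) (g : C(Plane, ℝ)), IntegrableOn (fun x =>
      f x * sinProd (m * Real.pi / a) (n * Real.pi / b) x * g x) (openRect a b) := fun m n g =>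
    integrableOn_openRect_mul (integrableOn_openRect_mul hf (continuous_sinProd _ _)) g.continuous
  have hadd : ∀ g₁ g₂, P g₁ → P g₂ → P (g₁ + g₂) := by
    intro g₁ g₂ h₁ h₂ m n
    simp only [ContinuousMap.add_apply, mul_add]
    rw [integral_add (hint m n g₁) (hint m n g₂), h₁, h₂, add_zero]
  have hsmul : ∀ (r : ℝ) g₁, P g₁ → P (algebraMap ℝ C(Plane, ℝ) r * g₁) := by
    intro r g₁ h₁ m n
    have : ∀ x, f x * sinProd (m * Real.pi / a) (n * Real.pi / b) x
        * (algebraMap ℝ C(Plane, ℝ) r * g₁) x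
        = r * (f x * sinProd (m * Real.pi / a) (n * Real.pi / b) x * g₁ x) := by
      intro x
      have hr : algebraMap ℝ C(Plane, ℝ) r x = r := by simp [Algebra.algebraMap_eq_smul_one]
      rw [ContinuousMap.mul_apply, hr]
      ring
    simp_rw [this]
    rw [integral_const_mul, h₁, mul_zero]
  have hone : P 1 := fun m n => by simpa using h m n
  have hsc : ∀ (m : ℤ) (γ s : ℝ), Real.sin (m * Real.pi / γ * s) * Real.cos (Real.pi / γ * s)
      = (Real.sin ((m + 1 : ℤ) * Real.pi / γ * s) + Real.sin ((m - 1 : ℤ) * Real.pi / γ * s)) / 2 := by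
    intro m γ s
    have h1 : ((m + 1 : ℤ) : ℝ) * Real.pi / γ * s
        = m * Real.pi / γ * s + Real.pi / γ * s := by push_cast; ring
    have h2 : ((m - 1 : ℤ) : ℝ) * Real.pi / γ * s
        = m * Real.pi / γ * s - Real.pi / γ * s := by push_cast; ring
    rw [h1, h2, Real.sin_add, Real.sin_sub]; ring
  have hX : ∀ g₁, P g₁ → P (cosCoord (Real.pi / a) 0 * g₁) := by
    intro g₁ h₁ m n
    have : ∀ x, f x * sinProd (m * Real.pi / a) (n * Real.pi / b) x
        * (cosCoord (Real.pi / a) 0 * g₁) x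
        = (f x * sinProd ((m + 1 : ℤ) * Real.pi / a) (n * Real.pi / b) x * g₁ x
          + f x * sinProd ((m - 1 : ℤ) * Real.pi / a) (n * Real.pi / b) x * g₁ x) / 2 := by
      intro x
      have := hsc m a (x 0)
      simp only [sinProd, ContinuousMap.mul_apply, cosCoord, ContinuousMap.coe_mk]
      linear_combination f x * Real.sin (n * Real.pi / b * x 1) * g₁ x * this
    simp_rw [this]
    rw [integral_div, integral_add (hint _ n g₁) (hint _ n g₁), h₁, h₁]
    simp
  have hY : ∀ g₁, P g₁ → P (cosCoord (Real.pi / b) 1 * g₁) := by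
    intro g₁ h₁ m n
    have : ∀ x, f x * sinProd (m * Real.pi / a) (n * Real.pi / b) x
        * (cosCoord (Real.pi / b) 1 * g₁) x
        = (f x * sinProd (m * Real.pi / a) ((n + 1 : ℤ) * Real.pi / b) x * g₁ x
          + f x * sinProd (m * Real.pi / a) ((n - 1 : ℤ) * Real.pi / b) x * g₁ x) / 2 := by
      intro x
      have := hsc n b (x 1)
      simp only [sinProd, ContinuousMap.mul_apply, cosCoord, ContinuousMap.coe_mk]
      linear_combination f x * Real.sin (m * Real.pi / a * x 0) * g₁ x * this
    simp_rw [this]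
    rw [integral_div, integral_add (hint m _ g₁) (hint m _ g₁), h₁, h₁]
    simp
  -- The induction is on `g` acting as a multiplier that preserves `P`; this form is stable under
  -- products. It is then applied to the constant 1.
  have key : ∀ g₁, P g₁ → P (g * g₁) := by
    induction hg using Algebra.adjoin_induction with
    | mem x hx =>
      rcases hx with rfl | hx
      · exact hX
      · rw [Set.mem_singleton_iff] at hx
        subst hx
        exact hY
    | algebraMap r => exact hsmul r
    | add x y _ _ hx hy =>
      intro g₁ h₁
      rw [add_mul]
      exact hadd _ _ (hx _ h₁) (hy _ h₁)
    | mul x y _ _ hx hy =>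
      intro g₁ h₁
      rw [mul_assoc]
      exact hx _ (hy _ h₁)
  have := key 1 hone m n
  rwa [mul_one] at this

/-- Stone–Weierstrass: `cos (π s / c)` is injective on `[0, c]`, so the two cosines separate the
points of the closed rectangle. -/
theorem exists_adjoin_cosCoord_near {a b : ℝ} (ha : 0 < a) (hb : 0 < b) {ψ : Plane → ℝ}
    (hψ : Continuous ψ) {ε : ℝ} (hε : 0 < ε) :
    ∃ g ∈ Algebra.adjoin ℝ {cosCoord (Real.pi / a) 0, cosCoord (Real.pi / b) 1},
      ∀ x ∈ closedRect a b, ‖g x - ψ x‖ < ε := by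
  set K := closedRect a b
  have : CompactSpace K := isCompact_iff_compactSpace.1 (isCompact_closedRect a b)
  set A := Algebra.adjoin ℝ {cosCoord (Real.pi / a) 0, cosCoord (Real.pi / b) 1}
  let R : C(Plane, ℝ) →⋆ₐ[ℝ] C(K, ℝ) :=
    ContinuousMap.compStarAlgHom' ℝ ℝ ⟨Subtype.val, continuous_subtype_val⟩
  have hinj : ∀ c : ℝ, 0 < c → ∀ s t : ℝ, 0 ≤ s → s ≤ c → 0 ≤ t → t ≤ c →
      Real.cos (Real.pi / c * s) = Real.cos (Real.pi / c * t) → s = t := by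
    intro c hc s t hs hs' ht ht' h
    have hpc : 0 < Real.pi / c := div_pos Real.pi_pos hc
    have hmem : ∀ r : ℝ, 0 ≤ r → r ≤ c → Real.pi / c * r ∈ Set.Icc 0 Real.pi := fun r hr hr' =>
      ⟨by positivity, by
        calc Real.pi / c * r ≤ Real.pi / c * c := by gcongr
          _ = Real.pi := by field_simp⟩
    exact mul_left_cancel₀ hpc.ne' (Real.injOn_cos (hmem s hs hs') (hmem t ht ht') h)
  have hsep : (Subalgebra.map (R : C(Plane, ℝ) →ₐ[ℝ] C(K, ℝ)) A).SeparatesPoints := by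
    rintro ⟨x, hx1, hx2, hx3, hx4⟩ ⟨y, hy1, hy2, hy3, hy4⟩ hxy
    by_cases h0 : x 0 = y 0
    · have h1 : x 1 ≠ y 1 := fun h1 => hxy (Subtype.ext (by
        ext k; fin_cases k
        · exact h0
        · exact h1))
      refine ⟨_, ⟨R (cosCoord (Real.pi / b) 1), ⟨_, Algebra.subset_adjoin (by simp), rfl⟩, rfl⟩, ?_⟩
      exact fun h => h1 (hinj b hb _ _ hx3 hx4 hy3 hy4 h)
    · refine ⟨_, ⟨R (cosCoord (Real.pi / a) 0), ⟨_, Algebra.subset_adjoin (by simp), rfl⟩, rfl⟩, ?_⟩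
      exact fun h => h0 (hinj a ha _ _ hx1 hx2 hy1 hy2 h)
  obtain ⟨⟨g, hg⟩, hgψ⟩ := ContinuousMap.exists_mem_subalgebra_near_continuous_of_separatesPoints _
    hsep (fun x : K => ψ x) (hψ.comp continuous_subtype_val) ε hε
  obtain ⟨g', hg', rfl⟩ := Subalgebra.mem_map.1 hg
  exact ⟨g', hg', fun x hx => hgψ ⟨x, hx⟩⟩

/-- The product of `f` with the first eigenfunction is orthogonal to all polynomials in the two
cosines, hence to all continuous functions, and so is zero almost everywhere. The first
eigenfunction is positive on the open rectangle and can be divided out. -/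
theorem ae_eq_zero_of_integral_sinProd {a b : ℝ} (ha : 0 < a) (hb : 0 < b) {f : Plane → ℝ}
    (hf : IntegrableOn f (openRect a b))
    (h : ∀ m n : ℕ, ∫ x in openRect a b,
      f x * sinProd ((m + 1 : ℕ) * Real.pi / a) ((n + 1 : ℕ) * Real.pi / b) x = 0) :
    f =ᵐ[volume.restrict (openRect a b)] 0 := by
  set Q := openRect a b with hQ
  have hQm : MeasurableSet Q := (isOpen_openRect a b).measurableSet
  have hsgn : ∀ m : ℤ, (∃ k : ℕ, m = (k + 1 : ℕ)) ∨ m = 0 ∨ ∃ k : ℕ, m = -((k + 1 : ℕ) : ℤ) := by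
    intro m
    rcases lt_trichotomy m 0 with hm | hm | hm
    · exact Or.inr (Or.inr ⟨(-m - 1).toNat, by omega⟩)
    · exact Or.inr (Or.inl hm)
    · exact Or.inl ⟨(m - 1).toNat, by omega⟩
  have hneg1 : ∀ (α β : ℝ) x, sinProd (-α) β x = -sinProd α β x := fun α β x => by
    simp [sinProd]
  have hneg2 : ∀ (α β : ℝ) x, sinProd α (-β) x = -sinProd α β x := fun α β x => by
    simp [sinProd]
  -- The sine products are odd in each index and vanish at index 0, so positive indices suffice.
  have hZ : ∀ m n : ℤ, ∫ x in Q, f x * sinProd (m * Real.pi / a) (n * Real.pi / b) x = 0 := by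
    have hn : ∀ (m : ℕ) (n : ℤ),
        ∫ x in Q, f x * sinProd ((m + 1 : ℕ) * Real.pi / a) (n * Real.pi / b) x = 0 := by
      intro m n
      rcases hsgn n with ⟨k, rfl⟩ | rfl | ⟨k, rfl⟩
      · simpa using h m k
      · simp [sinProd]
      · have : ((-((k + 1 : ℕ) : ℤ) : ℤ) : ℝ) * Real.pi / b = -(((k + 1 : ℕ) : ℝ) * Real.pi / b) := by
          push_cast; ring
        simp_rw [this, hneg2, mul_neg]
        rw [integral_neg, h m k, neg_zero]
    intro m n
    rcases hsgn m with ⟨k, rfl⟩ | rfl | ⟨k, rfl⟩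
    · simpa using hn k n
    · simp [sinProd]
    · have : ((-((k + 1 : ℕ) : ℤ) : ℤ) : ℝ) * Real.pi / a = -(((k + 1 : ℕ) : ℝ) * Real.pi / a) := by
        push_cast; ring
      simp_rw [this, hneg1, mul_neg]
      rw [integral_neg, hn k n, neg_zero]
  set F : Plane → ℝ := fun x => f x * sinProd ((1 : ℤ) * Real.pi / a) ((1 : ℤ) * Real.pi / b) x with hF
  have hFi : IntegrableOn F Q := integrableOn_openRect_mul hf (continuous_sinProd _ _)
  have hFz : ∀ ψ : Plane → ℝ, Continuous ψ → ∫ x in Q, F x * ψ x = 0 := by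
    intro ψ hψ
    set I := ∫ x in Q, ‖F x‖ with hI
    have hI0 : 0 ≤ I := integral_nonneg fun _ => norm_nonneg _
    have hb' : ∀ ε > 0, ‖∫ x in Q, F x * ψ x‖ ≤ ε * I := by
      intro ε hε
      obtain ⟨g, hg, hgε⟩ := exists_adjoin_cosCoord_near ha hb hψ hε
      have e0 : ∫ x in Q, F x * g x = 0 := integral_sinProd_mul_adjoin hf hZ hg 1 1
      have e1 : ∫ x in Q, F x * ψ x = -∫ x in Q, F x * (g x - ψ x) := by
        simp_rw [mul_sub]
        rw [integral_sub (integrableOn_openRect_mul hFi g.continuous)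
          (integrableOn_openRect_mul hFi hψ), e0, zero_sub, neg_neg]
      rw [e1, norm_neg, hI, ← integral_const_mul]
      refine norm_integral_le_of_norm_le (hFi.norm.const_mul ε) ?_
      filter_upwards [ae_restrict_mem hQm] with x hx
      rw [norm_mul, mul_comm]
      exact mul_le_mul_of_nonneg_right (hgε x (openRect_subset_closedRect a b hx)).le (norm_nonneg _)
    have : ‖∫ x in Q, F x * ψ x‖ ≤ 0 := by
      refine le_of_forall_pos_le_add fun δ hδ => ?_
      have := hb' (δ / (I + 1)) (by positivity)
      refine this.trans ?_
      rw [zero_add, div_mul_eq_mul_div, div_le_iff₀ (by positivity)]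
      nlinarith
    exact norm_le_zero_iff.1 this
  have hF0 : ∀ᵐ x, x ∈ Q → F x = 0 := by
    refine (isOpen_openRect a b).ae_eq_zero_of_integral_contDiff_smul_eq_zero
      hFi.locallyIntegrableOn fun ψ hψ hψc hψs => ?_
    rw [← hFz ψ hψ.continuous, ← setIntegral_eq_integral_of_forall_compl_eq_zero (s := Q)]
    · simp_rw [smul_eq_mul, mul_comm]
    · intro x hx
      rw [image_eq_zero_of_notMem_tsupport fun h' => hx (hψs h'), zero_smul]
  rw [EventuallyEq, ae_restrict_iff' hQm]
  filter_upwards [hF0] with x hx hxQ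
  have hsin : ∀ c : ℝ, 0 < c → ∀ s : ℝ, 0 < s → s < c →
      0 < Real.sin (((1 : ℤ) : ℝ) * Real.pi / c * s) := by
    intro c hc s hs hs'
    refine Real.sin_pos_of_pos_of_lt_pi (by have := Real.pi_pos; positivity) ?_
    calc ((1 : ℤ) : ℝ) * Real.pi / c * s < ((1 : ℤ) : ℝ) * Real.pi / c * c := by
          have := Real.pi_pos
          gcongr
      _ = Real.pi := by field_simp; simp
  have h1 := hx hxQ
  obtain ⟨q1, q2, q3, q4⟩ := hxQ
  have hpos := mul_pos (hsin a ha _ q1 q2) (hsin b hb _ q3 q4)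
  exact (mul_eq_zero.1 h1).resolve_right hpos.ne'

/-! ### Eigenfunctions of a rectangle -/

theorem frontier_openRect_subset (a b : ℝ) {x : Plane} (hx : x ∈ frontier (openRect a b)) :
    x 0 = 0 ∨ x 0 = a ∨ x 1 = 0 ∨ x 1 = b := by
  rw [frontier, (isOpen_openRect a b).interior_eq] at hx
  obtain ⟨h1, h2, h3, h4⟩ :=
    closure_minimal (openRect_subset_closedRect a b) (isClosed_closedRect a b) hx.1
  by_contra! h
  exact hx.2 ⟨lt_of_le_of_ne h1 (Ne.symm h.1), lt_of_le_of_ne h2 h.2.1,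
    lt_of_le_of_ne h3 (Ne.symm h.2.2.1), lt_of_le_of_ne h4 h.2.2.2⟩

theorem sin_nat_mul_pi_div_self {a : ℝ} (ha : a ≠ 0) (m : ℕ) :
    Real.sin (m * Real.pi / a * a) = 0 := by
  rw [div_mul_cancel₀ _ ha, Real.sin_nat_mul_pi]

theorem integral_sinProd_mul_sinProd {a b : ℝ} (ha : 0 < a) (hb : 0 < b) {m n m' n' : ℕ}
    (hm : 0 < m) (hn : 0 < n) :
    ∫ x in openRect a b, sinProd (m * Real.pi / a) (n * Real.pi / b) x
      * sinProd (m' * Real.pi / a) (n' * Real.pi / b) x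
      = (if m = m' then a / 2 else 0) * if n = n' then b / 2 else 0 := by
  rw [← integral_sin_mul_sin ha hm, ← integral_sin_mul_sin hb hn, ← setIntegral_openRect_mul]
  refine integral_congr_ae (Eventually.of_forall fun x => ?_)
  simp only [sinProd]
  ring

theorem isEigenSystem_openRect {a b : ℝ} (ha : 0 < a) (hb : 0 < b) :
    IsEigenSystem (openRect a b)
      (fun p : ℕ × ℕ => ((p.1 + 1 : ℕ) * Real.pi / a) ^ 2 + ((p.2 + 1 : ℕ) * Real.pi / b) ^ 2)
      (fun p => trigFun (2 / √(a * b)) 0 ((p.1 + 1 : ℕ) * Real.pi / a)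
        ((p.2 + 1 : ℕ) * Real.pi / b)) where
  isOpen := isOpen_openRect a b
  isBounded := (isCompact_closedRect a b).isBounded.subset (openRect_subset_closedRect a b)
  contDiff p := contDiff_trigFun _ _ _ _
  frontier_eq_zero p x hx := by
    rcases frontier_openRect_subset a b hx with h | h | h | h <;>
      simp only [trigFun, sinProd, h, mul_zero, Real.sin_zero, zero_mul, sub_zero,
        sin_nat_mul_pi_div_self ha.ne', sin_nat_mul_pi_div_self hb.ne']
  weak p ψ hψ hψc _ := integral_inner_gradient_eq (contDiff_trigFun _ _ _ _)
    (trigFun_laplacian _ _ _ _) hψ hψc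
  ortho := by
    rintro ⟨m, n⟩ ⟨m', n'⟩
    -- Each squared sine contributes half the edge length, so the squared norm of a sine product is
    -- `a * b / 4`.
    have hc : (2 / √(a * b)) ^ 2 = 4 / (a * b) := by
      rw [div_pow, Real.sq_sqrt (by positivity)]; norm_num
    have e : ∀ x, trigFun (2 / √(a * b)) 0 ((m + 1 : ℕ) * Real.pi / a) ((n + 1 : ℕ) * Real.pi / b) x
        * trigFun (2 / √(a * b)) 0 ((m' + 1 : ℕ) * Real.pi / a) ((n' + 1 : ℕ) * Real.pi / b) x
        = 4 / (a * b) * (sinProd ((m + 1 : ℕ) * Real.pi / a) ((n + 1 : ℕ) * Real.pi / b) x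
          * sinProd ((m' + 1 : ℕ) * Real.pi / a) ((n' + 1 : ℕ) * Real.pi / b) x) := by
      intro x
      rw [← hc]
      simp only [trigFun]
      ring
    simp_rw [e]
    rw [integral_const_mul,
      integral_sinProd_mul_sinProd ha hb (Nat.succ_pos _) (Nat.succ_pos _)]
    by_cases hm : m = m'
    · by_cases hn : n = n'
      · rw [if_pos (by omega), if_pos (by omega), if_pos (by rw [hm, hn])]
        field_simp
        norm_num
      · rw [if_neg (show ¬n.succ = n' + 1 by omega), if_neg (show ¬((m, n) = (m', n')) by simp [hn])]
        simp
    · rw [if_neg (show ¬m.succ = m' + 1 by omega), if_neg (show ¬((m, n) = (m', n')) by simp [hm])]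
      simp
  complete f hf h0 := by
    refine ae_eq_zero_of_integral_sinProd ha hb hf fun m n => ?_
    have := h0 (m, n)
    have e : ∀ x, f x * trigFun (2 / √(a * b)) 0 ((m + 1 : ℕ) * Real.pi / a)
        ((n + 1 : ℕ) * Real.pi / b) x = 2 / √(a * b) *
        (f x * sinProd ((m + 1 : ℕ) * Real.pi / a) ((n + 1 : ℕ) * Real.pi / b) x) := by
      intro x
      simp only [trigFun]
      ring
    simp_rw [e] at this
    rw [integral_const_mul] at this
    exact (mul_eq_zero.1 this).resolve_left (by positivity)

/-! ### Eigenfunctions of a right isosceles triangle -/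

/-- The reflection of the plane in the diagonal. -/
noncomputable def planeSwap : Plane ≃ᵃⁱ[ℝ] Plane :=
  (LinearIsometryEquiv.piLpCongrLeft 2 ℝ ℝ (Equiv.swap (0 : Fin 2) 1)).toAffineIsometryEquiv

theorem planeSwap_zero (x : Plane) : planeSwap x 0 = x 1 := rfl

theorem planeSwap_one (x : Plane) : planeSwap x 1 = x 0 := rfl

theorem planeSwap_planeSwap (x : Plane) : planeSwap (planeSwap x) = x := by
  ext k
  fin_cases k <;> rfl

theorem sinProd_planeSwap (α β : ℝ) (x : Plane) : sinProd α β (planeSwap x) = sinProd β α x := by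
  rw [sinProd, planeSwap_zero, planeSwap_one, sinProd, mul_comm]

/-- The open right isosceles triangle with vertices `(0, 0)`, `(c, 0)`, `(c, c)`. -/
def openTri (c : ℝ) : Set Plane := {x : Plane | 0 < x 1 ∧ x 1 < x 0 ∧ x 0 < c}

theorem isOpen_openTri (c : ℝ) : IsOpen (openTri c) :=
  (isOpen_lt continuous_const (continuous_coord 1)).inter
    ((isOpen_lt (continuous_coord 1) (continuous_coord 0)).inter
      (isOpen_lt (continuous_coord 0) continuous_const))

theorem openTri_subset_openRect (c : ℝ) : openTri c ⊆ openRect c c :=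
  fun _ ⟨h1, h2, h3⟩ => ⟨h1.trans h2, h3, h1, h2.trans h3⟩

theorem frontier_openTri_subset (c : ℝ) {x : Plane} (hx : x ∈ frontier (openTri c)) :
    x 1 = 0 ∨ x 1 = x 0 ∨ x 0 = c := by
  rw [frontier, (isOpen_openTri c).interior_eq] at hx
  have hcl : IsClosed {x : Plane | 0 ≤ x 1 ∧ x 1 ≤ x 0 ∧ x 0 ≤ c} :=
    (isClosed_le continuous_const (continuous_coord 1)).inter
      ((isClosed_le (continuous_coord 1) (continuous_coord 0)).inter
        (isClosed_le (continuous_coord 0) continuous_const))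
  have hsub : openTri c ⊆ {x : Plane | 0 ≤ x 1 ∧ x 1 ≤ x 0 ∧ x 0 ≤ c} :=
    fun _ ⟨h1, h2, h3⟩ => ⟨h1.le, h2.le, h3.le⟩
  obtain ⟨h1, h2, h3⟩ := closure_minimal hsub hcl hx.1
  by_contra! h
  exact hx.2 ⟨lt_of_le_of_ne h1 (Ne.symm h.1), lt_of_le_of_ne h2 h.2.1, lt_of_le_of_ne h3 h.2.2⟩

/-- The antisymmetric extension of a function from a triangle to the square. -/
noncomputable def antisymmExt (c : ℝ) (g : Plane → ℝ) (x : Plane) : ℝ :=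
  (openTri c).indicator g x - (openTri c).indicator g (planeSwap x)

theorem antisymmExt_of_mem {c : ℝ} {g : Plane → ℝ} {x : Plane} (hx : x ∈ openTri c) :
    antisymmExt c g x = g x := by
  have : planeSwap x ∉ openTri c := fun h => by
    have h1 := hx.2.1
    have h2 : planeSwap x 1 < planeSwap x 0 := h.2.1
    rw [planeSwap_zero, planeSwap_one] at h2
    linarith
  rw [antisymmExt, Set.indicator_of_mem hx, Set.indicator_of_notMem this, sub_zero]

theorem antisymmExt_of_forall {c : ℝ} {g : Plane → ℝ} (hg : ∀ x, g (planeSwap x) = -g x) {x : Plane}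
    (hx : x ∈ openRect c c) : antisymmExt c g x = g x := by
  obtain ⟨h1, h2, h3, h4⟩ := hx
  rcases lt_trichotomy (x 1) (x 0) with h | h | h
  · exact antisymmExt_of_mem ⟨h3, h, h2⟩
  · have hs : planeSwap x = x := by
      ext k
      fin_cases k
      · exact h
      · exact h.symm
    have := hg x
    rw [hs] at this
    rw [antisymmExt, hs, sub_self]
    linarith
  · have hm : planeSwap x ∈ openTri c := ⟨h1, h, h4⟩
    have hn : x ∉ openTri c := fun h' => by
      have := h'.2.1
      linarith
    rw [antisymmExt, Set.indicator_of_mem hm, Set.indicator_of_notMem hn, hg]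
    ring

theorem integrable_antisymmExt {c : ℝ} {g : Plane → ℝ} (hg : IntegrableOn g (openTri c)) :
    Integrable (antisymmExt c g) := by
  have h1 := (integrable_indicator_iff (isOpen_openTri c).measurableSet).2 hg
  exact h1.sub ((planeSwap.measurePreserving_plane.integrable_comp_emb
    planeSwap.measurableEmbedding_plane).2 h1)

/-- Unfolding along the diagonal: antisymmetrising `A` on the triangle amounts to antisymmetrising
`g` on the square. Both orthogonality and completeness on the triangle reduce to the square through
this. -/
theorem integral_openTri_mul_sub {c : ℝ} {g A : Plane → ℝ} (hg : IntegrableOn g (openTri c))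
    (hA : Continuous A) :
    ∫ x in openTri c, g x * (A x - A (planeSwap x)) = ∫ x in openRect c c, antisymmExt c g x * A x := by
  set T := openTri c with hT
  have hTm : MeasurableSet T := (isOpen_openTri c).measurableSet
  have hs : Continuous planeSwap := planeSwap.continuous
  have hint : ∀ B : Plane → ℝ, Continuous B → IntegrableOn (fun x => g x * B x) T := fun B hB =>
    hg.mul_continuousOn_of_subset hB.continuousOn hTm (isCompact_closedRect c c)
      ((openTri_subset_openRect c).trans (openRect_subset_closedRect c c))
  have hz : ∀ x, x ∉ openRect c c → antisymmExt c g x * A x = 0 := by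
    intro x hx
    have h1 : x ∉ openTri c := fun h => hx (openTri_subset_openRect c h)
    have h2 : planeSwap x ∉ openTri c := fun h => by
      obtain ⟨k1, k2, k3, k4⟩ := openTri_subset_openRect c h
      exact hx ⟨k3, k4, k1, k2⟩
    rw [antisymmExt, Set.indicator_of_notMem h1, Set.indicator_of_notMem h2, sub_zero, zero_mul]
  rw [setIntegral_eq_integral_of_forall_compl_eq_zero hz]
  set G₁ : Plane → ℝ := T.indicator fun x => g x * A x with hG₁
  set G₂ : Plane → ℝ := T.indicator fun x => g x * A (planeSwap x) with hG₂
  have e : ∀ x, antisymmExt c g x * A x = G₁ x - G₂ (planeSwap x) := by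
    intro x
    rw [antisymmExt, sub_mul]
    congr 1
    · by_cases hx : x ∈ T <;> simp [hG₁, hx, ← hT]
    · by_cases hx : planeSwap x ∈ T <;> simp [hG₂, hx, ← hT, planeSwap_planeSwap]
  have i1 : Integrable G₁ := (integrable_indicator_iff hTm).2 (hint A hA)
  have i2 : Integrable G₂ := (integrable_indicator_iff hTm).2 (hint _ (hA.comp hs))
  have i3 : Integrable fun x => G₂ (planeSwap x) :=
    (planeSwap.measurePreserving_plane.integrable_comp_emb
      planeSwap.measurableEmbedding_plane).2 i2
  simp_rw [e]
  rw [integral_sub i1 i3, planeSwap.measurePreserving_plane.integral_comp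
    planeSwap.measurableEmbedding_plane G₂, integral_indicator hTm, integral_indicator hTm]
  simp_rw [mul_sub]
  exact integral_sub (hint A hA) (hint _ (hA.comp hs))

theorem trigFun_eq_sub_planeSwap (k α β : ℝ) (x : Plane) :
    trigFun k 1 α β x = k * (sinProd α β x - sinProd α β (planeSwap x)) := by
  rw [trigFun, sinProd_planeSwap, one_mul]

/-- The eigenfunctions are antisymmetrised sine products of the square, which vanish on the diagonal
as well. With `p > q` each antisymmetric combination occurs once up to sign. -/
theorem isEigenSystem_openTri {c : ℝ} (hc : 0 < c) :
    IsEigenSystem (openTri c)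
      (fun p : ℕ × ℕ => ((p.1 + 1 + (p.2 + 1) : ℕ) * Real.pi / c) ^ 2
        + ((p.1 + 1 : ℕ) * Real.pi / c) ^ 2)
      (fun p => trigFun (2 / c) 1 ((p.1 + 1 + (p.2 + 1) : ℕ) * Real.pi / c)
        ((p.1 + 1 : ℕ) * Real.pi / c)) where
  isOpen := isOpen_openTri c
  isBounded := (isCompact_closedRect c c).isBounded.subset
    ((openTri_subset_openRect c).trans (openRect_subset_closedRect c c))
  contDiff p := contDiff_trigFun _ _ _ _
  frontier_eq_zero p x hx := by
    rcases frontier_openTri_subset c hx with h | h | h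
    · simp [trigFun, sinProd, h]
    · simp only [trigFun, sinProd, h]; ring
    · simp only [trigFun, sinProd, h, sin_nat_mul_pi_div_self hc.ne']; ring
  weak p ψ hψ hψc _ := integral_inner_gradient_eq (contDiff_trigFun _ _ _ _)
    (trigFun_laplacian _ _ _ _) hψ hψc
  ortho := by
    rintro ⟨q, d⟩ ⟨q', d'⟩
    set α : ℝ := (q + 1 + (d + 1) : ℕ) * Real.pi / c with hα
    set β : ℝ := (q + 1 : ℕ) * Real.pi / c with hβ
    set α' : ℝ := (q' + 1 + (d' + 1) : ℕ) * Real.pi / c with hα'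
    set β' : ℝ := (q' + 1 : ℕ) * Real.pi / c with hβ'
    have hint : IntegrableOn (trigFun (2 / c) 1 α' β') (openTri c) :=
      ((contDiff_trigFun (2 / c) 1 α' β').continuous.continuousOn.integrableOn_compact
        (isCompact_closedRect c c)).mono_set
        ((openTri_subset_openRect c).trans (openRect_subset_closedRect c c))
    have e1 : ∀ x, trigFun (2 / c) 1 α β x * trigFun (2 / c) 1 α' β' x = 2 / c *
        (trigFun (2 / c) 1 α' β' x * (sinProd α β x - sinProd α β (planeSwap x))) := fun x => by
      rw [trigFun_eq_sub_planeSwap _ α β]; ring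
    have hanti : ∀ x, trigFun (2 / c) 1 α' β' (planeSwap x) = -trigFun (2 / c) 1 α' β' x :=
      fun x => by
        rw [trigFun_eq_sub_planeSwap, trigFun_eq_sub_planeSwap, planeSwap_planeSwap]; ring
    have e2 : ∫ x in openRect c c, antisymmExt c (trigFun (2 / c) 1 α' β') x * sinProd α β x
        = ∫ x in openRect c c, (2 / c * (sinProd α β x * sinProd α' β' x)
          - 2 / c * (sinProd α β x * sinProd β' α' x)) := by
      refine setIntegral_congr_fun (isOpen_openRect c c).measurableSet fun x hx => ?_
      rw [antisymmExt_of_forall hanti hx, trigFun]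
      ring
    have hi : ∀ γ δ : ℝ, IntegrableOn (fun x => 2 / c * (sinProd α β x * sinProd γ δ x))
        (openRect c c) := fun γ δ =>
      ((continuous_const.mul ((continuous_sinProd α β).mul
        (continuous_sinProd γ δ))).continuousOn.integrableOn_compact
        (isCompact_closedRect c c)).mono_set (openRect_subset_closedRect c c)
    simp_rw [e1]
    rw [integral_const_mul, integral_openTri_mul_sub hint (continuous_sinProd α β), e2,
      integral_sub (hi _ _) (hi _ _), integral_const_mul, integral_const_mul,
      integral_sinProd_mul_sinProd hc hc (by omega) (by omega),
      integral_sinProd_mul_sinProd hc hc (by omega) (by omega)]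
    -- The cross term would need `p = q'` and `q = p'`, which contradicts `p > q` and `p' > q'`.
    have hno : (if q + 1 + (d + 1) = q' + 1 then c / 2 else 0)
        * (if q + 1 = q' + 1 + (d' + 1) then c / 2 else 0) = 0 := by
      by_cases h : q + 1 + (d + 1) = q' + 1
      · rw [if_neg (show ¬q + 1 = q' + 1 + (d' + 1) by omega), mul_zero]
      · rw [if_neg h, zero_mul]
    rw [hno]
    by_cases hq : q = q'
    · by_cases hd : d = d'
      · rw [if_pos (by omega), if_pos (by omega), if_pos (by rw [hq, hd])]
        field_simp
        norm_num
      · rw [if_neg (show ¬q + 1 + (d + 1) = q' + 1 + (d' + 1) by omega),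
          if_neg (show ¬((q, d) = (q', d')) by simp [hd])]
        simp
    · rw [if_neg (show ¬q + 1 = q' + 1 by omega), if_neg (show ¬((q, d) = (q', d')) by simp [hq])]
      simp
  complete f hf h0 := by
    have hlt : ∀ q d : ℕ, ∫ x in openTri c, f x *
        (sinProd ((q + 1 + (d + 1) : ℕ) * Real.pi / c) ((q + 1 : ℕ) * Real.pi / c) x
        - sinProd ((q + 1 + (d + 1) : ℕ) * Real.pi / c) ((q + 1 : ℕ) * Real.pi / c) (planeSwap x))
        = 0 := by
      intro q d
      have := h0 (q, d)
      have e : ∀ x, f x * trigFun (2 / c) 1 ((q + 1 + (d + 1) : ℕ) * Real.pi / c)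
          ((q + 1 : ℕ) * Real.pi / c) x = 2 / c * (f x *
          (sinProd ((q + 1 + (d + 1) : ℕ) * Real.pi / c) ((q + 1 : ℕ) * Real.pi / c) x
          - sinProd ((q + 1 + (d + 1) : ℕ) * Real.pi / c) ((q + 1 : ℕ) * Real.pi / c)
            (planeSwap x))) := fun x => by
        rw [trigFun_eq_sub_planeSwap]; ring
      simp_rw [e] at this
      rw [integral_const_mul] at this
      exact (mul_eq_zero.1 this).resolve_left (by positivity)
    have hF := ae_eq_zero_of_integral_sinProd hc hc (integrable_antisymmExt hf).integrableOn
      fun m n => by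
        rw [← integral_openTri_mul_sub hf (continuous_sinProd _ _)]
        -- The extension must be orthogonal to all sine products of the square. Indices with `n < m`
        -- are the hypothesis, equal indices give a symmetric product, and `n > m` is the first case
        -- up to sign.
        rcases lt_trichotomy n m with h | h | h
        · have := hlt n (m - n - 1)
          rwa [show n + 1 + (m - n - 1 + 1) = m + 1 by omega] at this
        · subst h
          simp [sinProd_planeSwap]
        · have := hlt m (n - m - 1)
          rw [show m + 1 + (n - m - 1 + 1) = n + 1 by omega, ← neg_eq_zero, ← integral_neg] at this
          rw [← this]
          refine integral_congr_ae (Eventually.of_forall fun x => ?_)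
          simp only [sinProd_planeSwap]
          ring
    have hF' := ae_restrict_of_ae_restrict_of_subset (openTri_subset_openRect c) hF
    filter_upwards [hF', ae_restrict_mem (isOpen_openTri c).measurableSet] with x hx hxT
    rwa [antisymmExt_of_mem hxT] at hx

/-! ### Mean values of the first eigenfunctions -/

theorem integral_sin_pi_div {a : ℝ} (ha : 0 < a) :
    ∫ s in Set.Ioo 0 a, Real.sin (Real.pi / a * s) = 2 * a / Real.pi := by
  have hc : Real.pi / a ≠ 0 := (div_pos Real.pi_pos ha).ne'
  rw [← integral_Ioc_eq_integral_Ioo, ← intervalIntegral.integral_of_le ha.le,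
    intervalIntegral.integral_comp_mul_left Real.sin hc, integral_sin, div_mul_cancel₀ _ ha.ne']
  simp
  ring

theorem sq_integral_openRect_trigFun {a b : ℝ} (ha : 0 < a) (hb : 0 < b) :
    (∫ x in openRect a b, trigFun (2 / √(a * b)) 0 (Real.pi / a) (Real.pi / b) x) ^ 2
      = 64 * (a * b) / Real.pi ^ 4 := by
  have e : ∀ x, trigFun (2 / √(a * b)) 0 (Real.pi / a) (Real.pi / b) x
      = 2 / √(a * b) * (Real.sin (Real.pi / a * x 0) * Real.sin (Real.pi / b * x 1)) := by
    intro x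
    simp only [trigFun, sinProd]
    ring
  simp_rw [e]
  rw [integral_const_mul, setIntegral_openRect_mul a b (fun s => Real.sin (Real.pi / a * s))
    fun s => Real.sin (Real.pi / b * s), integral_sin_pi_div ha, integral_sin_pi_div hb, mul_pow,
    div_pow, Real.sq_sqrt (by positivity)]
  field_simp
  norm_num

theorem setIntegral_openTri {c : ℝ} {G : ℝ × ℝ → ℝ} (hG : Continuous G) :
    ∫ x in openTri c, G (x 0, x 1) = ∫ s in Set.Ioo 0 c, ∫ t in Set.Ioo 0 s, G (s, t) := by
  set T : Set (ℝ × ℝ) := {p | 0 < p.2 ∧ p.2 < p.1 ∧ p.1 < c} with hT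
  have hTo : IsOpen T := (isOpen_lt continuous_const continuous_snd).inter
    ((isOpen_lt continuous_snd continuous_fst).inter (isOpen_lt continuous_fst continuous_const))
  have h1 : ∫ x in openTri c, G (x 0, x 1) = ∫ p in T, G p :=
    measurePreserving_planeEquiv.setIntegral_preimage_emb planeEquiv.measurableEmbedding G T
  have hTs : T ⊆ Set.Icc 0 c ×ˢ Set.Icc 0 c := fun p ⟨k1, k2, k3⟩ =>
    ⟨⟨(k1.trans k2).le, k3.le⟩, ⟨k1.le, (k2.trans k3).le⟩⟩
  have hint : Integrable (T.indicator G) := (integrable_indicator_iff hTo.measurableSet).2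
    ((hG.continuousOn.integrableOn_compact (isCompact_Icc.prod isCompact_Icc)).mono_set hTs)
  rw [h1, ← integral_indicator hTo.measurableSet, Measure.volume_eq_prod, integral_prod _ hint,
    ← integral_indicator measurableSet_Ioo]
  congr 1
  funext s
  by_cases hs : s ∈ Set.Ioo 0 c
  · rw [Set.indicator_of_mem hs, ← integral_indicator measurableSet_Ioo]
    congr 1
    funext t
    by_cases ht : t ∈ Set.Ioo 0 s
    · rw [Set.indicator_of_mem ht, Set.indicator_of_mem (show (s, t) ∈ T from ⟨ht.1, ht.2, hs.2⟩)]
    · rw [Set.indicator_of_notMem ht, Set.indicator_of_notMem]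
      exact fun h => ht ⟨h.1, h.2.1⟩
  · rw [Set.indicator_of_notMem hs]
    have : ∀ t, T.indicator G (s, t) = 0 := fun t =>
      Set.indicator_of_notMem (fun h => hs ⟨h.1.trans h.2.1, h.2.2⟩) _
    simp [this]

/-- The sign does not matter, since only the square of this integral enters the heat content. -/
theorem integral_openTri_trigFun :
    ∫ x in openTri 2, trigFun 1 1 Real.pi (Real.pi / 2) x = -(32 / (3 * Real.pi ^ 2)) := by
  have hπ := Real.pi_ne_zero
  set G : ℝ × ℝ → ℝ := fun p => Real.sin (Real.pi * p.1) * Real.sin (Real.pi / 2 * p.2)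
    - Real.sin (Real.pi / 2 * p.1) * Real.sin (Real.pi * p.2) with hG
  have e : ∀ x : Plane, trigFun 1 1 Real.pi (Real.pi / 2) x = G (x 0, x 1) := fun x => by
    simp only [trigFun, sinProd, hG]; ring
  have hlin : ∀ γ s : ℝ, HasDerivAt (fun t : ℝ => γ * t) γ s := fun γ s => by
    simpa using (hasDerivAt_id s).const_mul γ
  -- By the double-angle formulas, with `θ = π s / 2`, the inner integral becomes a multiple of `sin
  -- θ (1 - cos θ)²`, which has a multiple of `(1 - cos θ)³` as primitive.
  have hinner : ∀ s ∈ Set.Ioo (0 : ℝ) 2, ∫ t in Set.Ioo 0 s, G (s, t)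
      = -(2 / Real.pi) * (Real.sin (Real.pi / 2 * s) * (1 - Real.cos (Real.pi / 2 * s)) ^ 2) := by
    intro s hs
    rw [← integral_Ioc_eq_integral_Ioo, ← intervalIntegral.integral_of_le hs.1.le]
    have hd : ∀ t ∈ Set.uIcc 0 s, HasDerivAt (fun t => Real.sin (Real.pi * s)
        * (-(2 / Real.pi) * Real.cos (Real.pi / 2 * t))
        - Real.sin (Real.pi / 2 * s) * (-(1 / Real.pi) * Real.cos (Real.pi * t))) (G (s, t)) t := by
      intro t _
      have h1 := (((hlin (Real.pi / 2) t).cos).const_mul (-(2 / Real.pi))).const_mul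
        (Real.sin (Real.pi * s))
      have h2 := (((hlin Real.pi t).cos).const_mul (-(1 / Real.pi))).const_mul
        (Real.sin (Real.pi / 2 * s))
      refine (h1.sub h2).congr_deriv ?_
      simp only [hG]
      field_simp
    rw [intervalIntegral.integral_eq_sub_of_hasDerivAt hd
      (Continuous.intervalIntegrable (by simp only [hG]; fun_prop) _ _)]
    have h2 : Real.pi * s = 2 * (Real.pi / 2 * s) := by ring
    rw [h2, Real.sin_two_mul, Real.cos_two_mul, mul_zero, mul_zero, Real.cos_zero]
    field_simp
    ring
  simp_rw [e]
  rw [setIntegral_openTri (by simp only [hG]; fun_prop),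
    setIntegral_congr_fun measurableSet_Ioo hinner, ← integral_Ioc_eq_integral_Ioo,
    ← intervalIntegral.integral_of_le (by norm_num)]
  have hd : ∀ s ∈ Set.uIcc (0 : ℝ) 2, HasDerivAt
      (fun s => -(4 / (3 * Real.pi ^ 2)) * (1 - Real.cos (Real.pi / 2 * s)) ^ 3)
      (-(2 / Real.pi) * (Real.sin (Real.pi / 2 * s) * (1 - Real.cos (Real.pi / 2 * s)) ^ 2)) s := by
    intro s _
    have h1 := ((((hlin (Real.pi / 2) s).cos).const_sub 1).pow 3).const_mul
      (-(4 / (3 * Real.pi ^ 2)))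
    refine h1.congr_deriv ?_
    push_cast
    field_simp
    ring
  rw [intervalIntegral.integral_eq_sub_of_hasDerivAt hd
    (Continuous.intervalIntegrable (by fun_prop) _ _)]
  rw [div_mul_cancel₀ _ (two_ne_zero), Real.cos_pi, mul_zero, Real.cos_zero]
  field_simp
  norm_num

/-! ### Rectangles and triangles in any position -/

theorem IsOpenRectangle.swap {a b : ℝ} {S : Set Plane} (h : IsOpenRectangle a b S) :
    IsOpenRectangle b a S := by
  obtain ⟨ha, hb, e, rfl⟩ := h
  refine ⟨hb, ha, planeSwap.trans e, ?_⟩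
  have : openRect a b = planeSwap '' openRect b a := by
    ext x
    constructor
    · rintro ⟨h1, h2, h3, h4⟩
      exact ⟨planeSwap x, ⟨h3, h4, h1, h2⟩, planeSwap_planeSwap x⟩
    · rintro ⟨y, ⟨h1, h2, h3, h4⟩, rfl⟩
      exact ⟨h3, h4, h1, h2⟩
  change e '' openRect a b = (planeSwap.trans e) '' openRect b a
  rw [this, Set.image_image]
  rfl

theorem IsOpenRectangle.exists_isEigenSystem {a b : ℝ} {S : Set Plane} (h : IsOpenRectangle a b S) :
    ∃ φ : ℕ × ℕ → Plane → ℝ, IsEigenSystem S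
      (fun p => ((p.1 + 1 : ℕ) * Real.pi / a) ^ 2 + ((p.2 + 1 : ℕ) * Real.pi / b) ^ 2) φ ∧
      (∫ x in S, φ (0, 0) x) ^ 2 = 64 * (a * b) / Real.pi ^ 4 := by
  obtain ⟨ha, hb, e, rfl⟩ := h
  refine ⟨_, (isEigenSystem_openRect ha hb).image e, ?_⟩
  change (∫ x in e '' openRect a b, _) ^ 2 = _
  rw [e.measurePreserving_plane.setIntegral_image_emb e.measurableEmbedding_plane,
    ← sq_integral_openRect_trigFun ha hb]
  simp

theorem IsOpenRectangle.volume_eq {a b : ℝ} {S : Set Plane} (h : IsOpenRectangle a b S) :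
    volume S = ENNReal.ofReal (a * b) := by
  obtain ⟨ha, hb, e, rfl⟩ := h
  change volume (e '' openRect a b) = _
  rw [ENNReal.ofReal_mul ha.le, ← volume_openRect,
    ← e.measurePreserving_plane.measure_preimage_emb e.measurableEmbedding_plane,
    Set.preimage_image_eq _ e.injective]

theorem IsOpenRightIsosceles.exists_isEigenSystem {T : Set Plane} (h : IsOpenRightIsosceles 2 T) :
    ∃ φ : ℕ × ℕ → Plane → ℝ, IsEigenSystem T
      (fun p => ((p.1 + 1 + (p.2 + 1) : ℕ) * Real.pi / 2) ^ 2
        + ((p.1 + 1 : ℕ) * Real.pi / 2) ^ 2) φ ∧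
      (∫ x in T, φ (0, 0) x) ^ 2 = 1024 / (9 * Real.pi ^ 4) := by
  obtain ⟨-, e, rfl⟩ := h
  refine ⟨_, (isEigenSystem_openTri two_pos).image e, ?_⟩
  change (∫ x in e '' openTri 2, _) ^ 2 = _
  have h2 := integral_openTri_trigFun
  have h3 : ((0 + 1 + (0 + 1) : ℕ) : ℝ) * Real.pi / 2 = Real.pi := by push_cast; ring
  have h4 : ((0 + 1 : ℕ) : ℝ) * Real.pi / 2 = Real.pi / 2 := by push_cast; ring
  rw [e.measurePreserving_plane.setIntegral_image_emb e.measurableEmbedding_plane]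
  simp only [Function.comp_apply, AffineIsometryEquiv.symm_apply_apply, h3, h4]
  rw [div_self two_ne_zero, h2]
  field_simp
  norm_num

/-! ### Spectrum and heat content of a disjoint union -/

/-- All that `C` and `D` have in common: integer levels in units of `π² / 4`, with every level but
one distinguished one at least 8, which is where the rate `8 * π² / 4 = 2π²` comes from. -/
theorem IsEigenSystem.heat_and_spectrum {κ : Type*} [Countable κ] {U : κ → Set Plane}
    {φ : κ → ℕ × ℕ → Plane → ℝ} {level : κ × ℕ × ℕ → ℕ}
    (h : ∀ k, IsEigenSystem (U k) (fun p => Real.pi ^ 2 / 4 * level (k, p)) (φ k))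
    (hd : Pairwise fun k l => Disjoint (U k) (U l)) (hvol : volume (⋃ k, U k) ≠ ⊤)
    (k₀ : κ) (p₀ : ℕ × ℕ) (h8 : ∀ p, p ≠ (k₀, p₀) → 8 ≤ level p) :
    HasUniqueHeatSolution (⋃ k, U k) ∧
    (∀ σ : ℕ ≃ κ × ℕ × ℕ, Monotone (level ∘ σ) → Tendsto (level ∘ σ) atTop atTop →
      IsDirichletSpectrum (⋃ k, U k) fun j => Real.pi ^ 2 / 4 * level (σ j)) ∧
    (fun t : ℝ => heatContent (⋃ k, U k) t - (∫ x in U k₀, φ k₀ p₀ x) ^ 2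
        * Real.exp (-(Real.pi ^ 2 / 4 * level (k₀, p₀) * t)))
      =O[atTop] (fun t : ℝ => Real.exp (-(2 * Real.pi ^ 2 * t))) := by
  have hfin : IsFiniteMeasure ((volume : Measure Plane).restrict (⋃ k, U k)) :=
    ⟨by rw [Measure.restrict_apply_univ]; exact hvol.lt_top⟩
  obtain ⟨b, hb, hbL⟩ := exists_hilbertBasis_iUnion h hd
  have hev : ∀ p : κ × ℕ × ℕ, 0 ≤ Real.pi ^ 2 / 4 * (level p : ℝ) := fun p => by positivity
  refine ⟨hasUniqueHeatSolution_of_hilbertBasis b hev hbL, fun σ hσ hσ' => ⟨?_, ?_, ?_⟩, ?_⟩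
  · intro i j hij
    have : level (σ i) ≤ level (σ j) := hσ hij
    have : (level (σ i) : ℝ) ≤ level (σ j) := by exact_mod_cast this
    simp only
    gcongr
  · exact (tendsto_natCast_atTop_atTop.comp hσ').const_mul_atTop (by positivity)
  · have hon : Orthonormal ℝ (b ∘ σ) := b.orthonormal.comp σ σ.injective
    have hsp : ⊤ ≤ (Submodule.span ℝ (Set.range (b ∘ σ))).topologicalClosure := by
      rw [σ.surjective.range_comp, b.dense_span]
    refine ⟨HilbertBasis.mk hon hsp, fun j => ?_⟩
    rw [HilbertBasis.coe_mk]
    exact hbL (σ j)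
  · have hint : ∫ x in ⋃ k, U k, b (k₀, p₀) x = ∫ x in U k₀, φ k₀ p₀ x := by
      rw [integral_congr_ae (hb (k₀, p₀)), setIntegral_indicator (h k₀).isOpen.measurableSet,
        Set.inter_eq_self_of_subset_right (Set.subset_iUnion U k₀)]
    refine IsBigO.of_bound (‖oneL2 (⋃ k, U k)‖ ^ 2) ?_
    filter_upwards [eventually_gt_atTop 0] with t ht
    have := abs_heatContent_sub_le b hev hbL (k₀, p₀) (ν := 2 * Real.pi ^ 2) (fun p hp => by
      have : (8 : ℝ) ≤ level p := by exact_mod_cast h8 p hp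
      nlinarith [sq_nonneg Real.pi]) ht
    rw [hint] at this
    rw [Real.norm_eq_abs, Real.norm_eq_abs, abs_of_pos (Real.exp_pos _)]
    exact this

/-- Otherwise subtraction would give `(q - p) exp (-(μ t)) = O(exp (-(ν t)))` with `q ≠ p` and `μ <
ν`. -/
theorem not_isoheat_of_isBigO {C D : Set Plane} {p q μ ν : ℝ} (hpq : p ≠ q) (hμν : μ < ν)
    (hC : (fun t : ℝ => heatContent C t - p * Real.exp (-(μ * t)))
      =O[atTop] (fun t : ℝ => Real.exp (-(ν * t))))
    (hD : (fun t : ℝ => heatContent D t - q * Real.exp (-(μ * t)))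
      =O[atTop] (fun t : ℝ => Real.exp (-(ν * t)))) : ¬Isoheat C D := by
  intro hiso
  have h1 : (fun t : ℝ => (q - p) * Real.exp (-(μ * t)))
      =O[atTop] (fun t : ℝ => Real.exp (-(ν * t))) := by
    refine (hC.sub hD).congr' ?_ EventuallyEq.rfl
    filter_upwards [eventually_gt_atTop 0] with t ht
    rw [hiso t ht]
    ring
  rw [isBigO_const_mul_left_iff (sub_ne_zero.2 hpq.symm), Real.isBigO_exp_comp_exp_comp] at h1
  refine not_isBoundedUnder_of_tendsto_atTop ?_ h1
  have : Tendsto (fun t : ℝ => (ν - μ) * t) atTop atTop :=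
    tendsto_id.const_mul_atTop (sub_pos.2 hμν)
  refine this.congr fun t => ?_
  simp only [Pi.sub_apply]
  ring

/-! ### The components of `C` and `D`, and the conclusion. -/

theorem two_rpow_neg_natCast (j : ℕ) : (2 : ℝ) ^ (-(j : ℝ)) = (2 ^ j)⁻¹ := by
  rw [Real.rpow_neg two_pos.le, Real.rpow_natCast]

theorem IsInfiniteChapmanBandC.exists_isEigenSystem {C : Set Plane}
    (hC : IsInfiniteChapmanBandC C) :
    ∃ (U : Option ℕ → Set Plane) (φ : Option ℕ → ℕ × ℕ → Plane → ℝ), C = ⋃ k, U k ∧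
      (∀ k, IsEigenSystem (U k) (fun p => Real.pi ^ 2 / 4 * levelC (k, p)) (φ k)) ∧
      (Pairwise fun k l => Disjoint (U k) (U l)) ∧ volume (⋃ k, U k) ≠ ⊤ ∧
      (∫ x in U none, φ none (0, 0) x) ^ 2 = 1024 / (9 * Real.pi ^ 4) := by
  obtain ⟨S, T, hS, ⟨c, hT, hc⟩, hdS, hdT, rfl⟩ := hC
  have hc2 : c = 2 := by have := hT.1; nlinarith
  subst hc2
  obtain ⟨ψ, hψ, hψ0⟩ := hT.exists_isEigenSystem
  choose s hs hss using hS
  choose φ hφ _ using fun j => (hs j).exists_isEigenSystem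
  refine ⟨fun k => k.elim T S, fun k => k.elim ψ φ, ?_, ?_, ?_, ?_, hψ0⟩
  · rw [Set.iUnion_option, Set.union_comm]; rfl
  · rintro (_ | j)
    · refine hψ.congr_ev fun p => ?_
      simp only [levelC]
      push_cast
      ring
    · refine (hφ j).congr_ev fun p => ?_
      have h2 : s j ^ 2 = (2 ^ j)⁻¹ := by rw [sq, hss j, two_rpow_neg_natCast]
      simp only [levelC, div_pow, h2]
      push_cast
      field_simp
  · rintro (_ | i) (_ | j) hij
    · exact absurd rfl hij
    · exact (hdT j).symm
    · exact hdT i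
    · exact hdS fun h => hij (by rw [h])
  · rw [Set.iUnion_option]
    refine ((measure_union_le _ _).trans_lt (ENNReal.add_lt_top.2 ⟨hψ.isBounded.measure_lt_top,
      (measure_iUnion_le _).trans_lt ?_⟩)).ne
    have e : ∀ j, volume (S j) = ENNReal.ofReal ((1 / 2) ^ j) := fun j => by
      rw [(hs j).volume_eq, hss j, two_rpow_neg_natCast]; simp
    simp only [Option.elim_some, e]
    exact summable_geometric_two.tsum_ofReal_ne_top.lt_top

theorem IsInfiniteChapmanBandD.exists_isEigenSystem {D : Set Plane}
    (hD : IsInfiniteChapmanBandD D) :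
    ∃ (U : ℕ → Set Plane) (φ : ℕ → ℕ × ℕ → Plane → ℝ), D = ⋃ k, U k ∧
      (∀ k, IsEigenSystem (U k) (fun p => Real.pi ^ 2 / 4 * levelD (k, p)) (φ k)) ∧
      (Pairwise fun k l => Disjoint (U k) (U l)) ∧ volume (⋃ k, U k) ≠ ⊤ ∧
      (∫ x in U 0, φ 0 (0, 0) x) ^ 2 = 1152 / (9 * Real.pi ^ 4) := by
  obtain ⟨R, hR, hdR, rfl⟩ := hD
  -- With `r = 2^(-j/2)`, area `2r²` and squared diagonal `5r²` give `(a + b)² = 9r²`, so the edges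
  -- are `r` and `2r`. Their order is not determined, hence the use of `IsOpenRectangle.swap`.
  have hR' : ∀ j, ∃ r : ℝ, IsOpenRectangle r (2 * r) (R j) ∧ r ^ 2 = (2 ^ j)⁻¹ := by
    intro j
    obtain ⟨a, b, hab, hprod, hdiam⟩ := hR j
    have ha := hab.1
    have hb := hab.2.1
    set r : ℝ := (2 : ℝ) ^ (-(j : ℝ) / 2) with hr
    have hr0 : 0 < r := by positivity
    have hr2 : r ^ 2 = (2 ^ j)⁻¹ := by
      rw [← two_rpow_neg_natCast, hr, ← Real.rpow_natCast, ← Real.rpow_mul two_pos.le]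
      congr 1
      push_cast
      ring
    have h1 : a * b = 2 * r ^ 2 := by
      rw [hprod, hr2, sub_eq_add_neg, Real.rpow_add two_pos, Real.rpow_one, two_rpow_neg_natCast]
    have h2 : a ^ 2 + b ^ 2 = 5 * r ^ 2 := by
      have := congrArg (· ^ 2) hdiam
      simp only [mul_pow] at this
      rw [Real.sq_sqrt (by positivity), Real.sq_sqrt (by norm_num)] at this
      linarith
    have h3 : a + b = 3 * r := by
      have : (a + b) ^ 2 = (3 * r) ^ 2 := by linarith
      exact (pow_left_inj₀ (by positivity) (by positivity) two_ne_zero).1 this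
    have h4 : (a - r) * (a - 2 * r) = 0 := by
      have hb' : b = 3 * r - a := by linarith
      rw [hb'] at h1
      linarith
    rcases mul_eq_zero.1 h4 with h | h
    · have e1 : a = r := by linarith
      have e2 : b = 2 * r := by linarith
      rw [e1, e2] at hab
      exact ⟨r, hab, hr2⟩
    · have e1 : a = 2 * r := by linarith
      have e2 : b = r := by linarith
      rw [e1, e2] at hab
      exact ⟨r, hab.swap, hr2⟩
  choose r hr hrr using hR'
  choose φ hφ hφ0 using fun j => (hr j).exists_isEigenSystem
  refine ⟨R, φ, rfl, fun j => (hφ j).congr_ev fun p => ?_, hdR, ?_, ?_⟩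
  · simp only [levelD, div_pow, mul_pow, hrr]
    push_cast
    field_simp
    ring
  · refine ((measure_iUnion_le _).trans_lt ?_).ne
    have e : ∀ j, volume (R j) = ENNReal.ofReal (2 * (1 / 2) ^ j) := fun j => by
      have : r j * (2 * r j) = 2 * r j ^ 2 := by ring
      rw [(hr j).volume_eq, this, hrr]; simp
    simp only [e]
    exact (summable_geometric_two.mul_left 2).tsum_ofReal_ne_top.lt_top
  · have : r 0 * (2 * r 0) = 2 * r 0 ^ 2 := by ring
    rw [hφ0, this, hrr]
    field_simp
    norm_num

theorem corollary2 (C D : Set Plane) (hC : IsInfiniteChapmanBandC C)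
    (hD : IsInfiniteChapmanBandD D) :
    HasUniqueHeatSolution C ∧ HasUniqueHeatSolution D ∧
    Isospectral C D ∧ ¬ Isoheat C D ∧
    (fun t : ℝ => heatContent C t -
        1024 / (9 * Real.pi ^ 4) * Real.exp (-(5 * Real.pi ^ 2 * t / 4)))
      =O[atTop] (fun t : ℝ => Real.exp (-(2 * Real.pi ^ 2 * t))) ∧
    (fun t : ℝ => heatContent D t -
        1152 / (9 * Real.pi ^ 4) * Real.exp (-(5 * Real.pi ^ 2 * t / 4)))
      =O[atTop] (fun t : ℝ => Real.exp (-(2 * Real.pi ^ 2 * t))) := by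
  obtain ⟨U, φ, rfl, hU, hdU, hvU, hcU⟩ := hC.exists_isEigenSystem
  obtain ⟨V, χ, rfl, hV, hdV, hvV, hcV⟩ := hD.exists_isEigenSystem
  obtain ⟨hC1, hC2, hC3⟩ := IsEigenSystem.heat_and_spectrum hU hdU hvU none (0, 0)
    fun _ => levelC_ge_eight
  obtain ⟨hD1, hD2, hD3⟩ := IsEigenSystem.heat_and_spectrum hV hdV hvV 0 (0, 0)
    fun _ => levelD_ge_eight
  rw [hcU, show levelC (none, 0, 0) = 5 from rfl] at hC3
  rw [hcV, show levelD (0, 0, 0) = 5 from rfl] at hD3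
  have hμ : ∀ t : ℝ, Real.pi ^ 2 / 4 * ((5 : ℕ) : ℝ) * t = 5 * Real.pi ^ 2 * t / 4 := fun t => by
    push_cast; ring
  refine ⟨hC1, hD1, ?_, not_isoheat_of_isBigO ?_ ?_ hC3 hD3, ?_, ?_⟩
  · obtain ⟨σ, hσ⟩ := exists_equiv_monotone levelD finite_levelD_le
    have hσ' := tendsto_atTop_of_finite_sublevel levelD finite_levelD_le σ
    let τ : ℕ × ℕ × ℕ ≃ Option ℕ × ℕ × ℕ := Equiv.ofBijective spectralMap spectralMap_bijective
    have hτ : ∀ j, levelC ((σ.trans τ) j) = levelD (σ j) := fun j => levelC_spectralMap (σ j)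
    have hτ' : levelC ∘ (σ.trans τ) = levelD ∘ σ := funext hτ
    refine ⟨fun j => Real.pi ^ 2 / 4 * levelD (σ j), ?_, hD2 σ hσ hσ'⟩
    have := hC2 (σ.trans τ) (by rwa [hτ']) (by rwa [hτ'])
    simpa only [hτ] using this
  · have := Real.pi_ne_zero
    rw [Ne, div_left_inj' (by positivity)]
    norm_num
  · have := Real.pi_pos
    push_cast
    nlinarith [sq_pos_of_pos this]
  · simpa only [hμ] using hC3
  · simpa only [hμ] using hD3
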